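/- Let $\mathbb{C}^{p\times q}$ carry the Frobenius norm $\|\cdot\|_F$, let $\|\cdot\|_2$ be the spectral norm of matrices, and let $\mathbb{C}\times\mathbb{C}^{n\times k}$ carry the norm $\|(\lambda,X)\|=\sqrt{|\lambda|^2+\|X\|_F^2}$. For a linear map $L$ between finite-dimensional complex inner product spaces, let $L_{\text{rank-}r}$ be its rank-$r$ projection (the rank-$r$ map closest to $L$ in the Frobenius norm, i.e. its rank-$r$ truncated SVD), $L^\dagger$ its Moore–Penrose inverse, $L_{\text{rank-}r}^\dagger=(L_{\text{rank-}r})^\dagger$, and $\|L\|$ its operator norm. Let $\hat\lambda$ be an eigenvalue of $A\in\mathbb{C}^{n\times n}$ with multiplicity support $m\times k$, that is, of geometric multiplicity $m$ and with smallest Jordan block size $k$. Let $S=[s_{ij}]\in\mathbb{C}^{k\times k}$ satisfy $s_{ij}=0$ for $i\ge j$ and $s_{12}s_{23}\cdots s_{k-1,k}\neq0$, put $\mathbf f(\lambda,X,G)=GX-\lambda X-XS$ for $\lambda\in\mathbb{C}$, $X\in\mathbb{C}^{n\times k}$, $G\in\mathbb{C}^{n\times n}$, let $\mathbf f_{\lambda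 X}$ be its partial Jacobian with respect to $(\lambda,X)$, and set $r=1+(n-m)k$. Let $\mathcal S=\{X\in\mathbb{C}^{n\times k} : \mathbf f(\hat\lambda,X,A)=O\}$, and let $\mathcal S_0$ be the set of those $X\in\mathcal S$ whose first column is not in the range of $(A-\hat\lambda I)^k$. Then $\mathcal S_0$ is dense in $\mathcal S$, and for $\hat X\in\mathcal S$ one has $\operatorname{rank}\mathbf f_{\lambda X}(\hat\lambda,\hat X,A)=r$ if and only if $\hat X\in\mathcal S_0$. Moreover, there is an absolute constant $\alpha>0$ such that for every such $A,\hat\lambda,S$ and every $\hat X\in\mathcal S_0$ there are constants $C,K\ge0$ with the following property. For every $\eta>0$ there are $\delta,\varepsilon>0$ such that, for every $\tilde A\in\mathbb{C}^{n\times n}$ with $\|\tilde A-A\|_F<\delta$ and every $(\lambda_0,X_0)$ with $\|(\lambda_0,X_0)-(\hat\lambda,\hat X)\|<\varepsilon$, the rank-$r$ Newton iteration $$(\lambda_{j+1},X_{j+1})=(\lambda_j,X_j)-\mathbf f_{\lambda X}(\lambda_j,X_j,\tilde A)_{\text{rank-}r}^\dagger\,\mathbf f(\lambda_j,X_j,\tilde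 A),\qquad j=0,1,\ldots,$$ is well defined (the rank-$r$ projections exist and are unique) and converges to a point $(\tilde\lambda,\tilde X)\in\mathbb{C}\times\mathbb{C}^{n\times k}$, and there is an exact solution $\check X\in\mathcal S_0$ with $\|\check X-\hat X\|_F<\eta$ and $$\|(\tilde\lambda,\tilde X)-(\hat\lambda,\check X)\|\le\alpha\,\big\|\mathbf f_{\lambda X}(\hat\lambda,\check X,A)_{\text{rank-}r}^\dagger\big\|\,\|\check X\|_2\,\|A-\tilde A\|_F+C\,\|A-\tilde A\|_F^2 .$$ If $\tilde A=A$, the convergence is quadratic: $\|(\lambda_{j+1},X_{j+1})-(\tilde\lambda,\tilde X)\|\le K\,\|(\lambda_j,X_j)-(\tilde\lambda,\tilde X)\|^2$ for all $j$. -/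

import Mathlib

open Filter Topology

/-- `n × k` complex matrices, as a Euclidean space: the norm is the Frobenius norm. -/
abbrev FMat (n k : ℕ) : Type := EuclideanSpace ℂ (Fin n × Fin k)

/-- The matrix with the given entries. -/
def toMat {n k : ℕ} (X : FMat n k) : Matrix (Fin n) (Fin k) ℂ :=
  Matrix.of fun i j => X (i, j)

/-- A matrix viewed in the space with the Frobenius norm. -/
def ofMat {n k : ℕ} (M : Matrix (Fin n) (Fin k) ℂ) : FMat n k :=
  WithLp.toLp 2 fun p => M p.1 p.2

/-- The spectral norm (operator norm for the Euclidean norms) of a matrix. -/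
noncomputable def specNorm {n k : ℕ} (X : FMat n k) : ℝ :=
  ‖LinearMap.toContinuousLinearMap (Matrix.toEuclideanLin (toMat X))‖

/-- The space `ℂ × ℂ^{n × k}` with the norm `√(|lam|² + ‖X‖_F²)`. -/
abbrev EigSpace (n k : ℕ) : Type := WithLp 2 (ℂ × FMat n k)

/-- The point `(lam, X)` of `ℂ × ℂ^{n × k}`. -/
def eigPt {n k : ℕ} (lam : ℂ) (X : FMat n k) : EigSpace n k := WithLp.toLp 2 (lam, X)

section RankProjection

variable {V W : Type*} [NormedAddCommGroup V] [InnerProductSpace ℂ V] [FiniteDimensional ℂ V]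
  [NormedAddCommGroup W] [InnerProductSpace ℂ W] [FiniteDimensional ℂ W]

/-- The rank of a linear map. -/
noncomputable def mapRank (L : V →L[ℂ] W) : ℕ :=
  Module.finrank ℂ (LinearMap.range (L : V →ₗ[ℂ] W))

/-- The Frobenius norm of a linear map, that is, of its matrix in orthonormal bases. -/
noncomputable def frobNorm (L : V →L[ℂ] W) : ℝ :=
  Real.sqrt (∑ i, ‖L (stdOrthonormalBasis ℂ V i)‖ ^ 2)

/-- `P` is a rank-`r` projection of `L`: it has rank `r`, and no map of rank `r` is closer to `L`
in the Frobenius norm. -/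
def IsRankProj (r : ℕ) (L P : V →L[ℂ] W) : Prop :=
  mapRank P = r ∧ ∀ Q : V →L[ℂ] W, mapRank Q = r → frobNorm (L - P) ≤ frobNorm (L - Q)

open Classical in
/-- The rank-`r` projection of `L` (meaningful where it exists and is unique). -/
noncomputable def rankProj (r : ℕ) (L : V →L[ℂ] W) : V →L[ℂ] W :=
  if h : ∃ P, IsRankProj r L P then h.choose else 0

/-- The Moore-Penrose inverse of `L`: project orthogonally onto the range of `L`, then invert the
bijection that `L` induces from the orthogonal complement of its kernel onto its range. -/
noncomputable def pinv (L : V →L[ℂ] W) : W →L[ℂ] V :=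
  LinearMap.toContinuousLinearMap
    ((LinearMap.ker (L : V →ₗ[ℂ] W))ᗮ.subtype ∘ₗ
      ((LinearMap.kerComplementEquivRange (L : V →ₗ[ℂ] W)
        (LinearMap.ker (L : V →ₗ[ℂ] W)).isCompl_orthogonal.symm).symm :
          LinearMap.range (L : V →ₗ[ℂ] W) →ₗ[ℂ] (LinearMap.ker (L : V →ₗ[ℂ] W))ᗮ) ∘ₗ
      ((LinearMap.range (L : V →ₗ[ℂ] W)).orthogonalProjectionOnto :
        W →ₗ[ℂ] LinearMap.range (L : V →ₗ[ℂ] W)))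

/-- One step of the rank-`r` Newton iteration for a map `f`, at the point `x`. -/
noncomputable def newtonStep (r : ℕ) (f : V → W) (x : V) : V :=
  x - pinv (rankProj r (fderiv ℂ f x)) (f x)

/-- The rank-`r` Newton iteration for `f` from the initial iterate `x₀`. -/
noncomputable def newtonSeq (r : ℕ) (f : V → W) (x₀ : V) : ℕ → V
  | 0 => x₀
  | j + 1 => newtonStep r f (newtonSeq r f x₀ j)

/-- The rank-`r` projection of the Jacobian of `f` at `x` exists and is unique. -/
def RankProjDefined (r : ℕ) (f : V → W) (x : V) : Prop :=
  ∃! P : V →L[ℂ] W, IsRankProj r (fderiv ℂ f x) P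

end RankProjection

/-- The Jordan block of size `s` with eigenvalue `μ`. -/
def jordanBlock (μ : ℂ) (s : ℕ) : Matrix (Fin s) (Fin s) ℂ :=
  Matrix.of fun i j => if i = j then μ else if (i : ℕ) + 1 = j then 1 else 0

/-- `A` has a Jordan canonical form whose `i`-th block, `i < q`, has eigenvalue `μ i` and
size `s i`. -/
def HasJordanForm {n q : ℕ} (A : Matrix (Fin n) (Fin n) ℂ) (μ : Fin q → ℂ) (s : Fin q → ℕ) :
    Prop :=
  (∀ i, 0 < s i) ∧
    ∃ (P : Matrix (Fin n) (Σ i, Fin (s i)) ℂ) (Q : Matrix (Σ i, Fin (s i)) (Fin n) ℂ),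
      P * Q = 1 ∧ Q * P = 1 ∧
        A = P * Matrix.blockDiagonal' (fun i => jordanBlock (μ i) (s i)) * Q

/-- `lam` is an eigenvalue of `A` of geometric multiplicity `m`, and `k` is the smallest size of a
Jordan block of `A` with eigenvalue `lam`. -/
def HasMultiplicitySupport {n : ℕ} (A : Matrix (Fin n) (Fin n) ℂ) (lam : ℂ) (m k : ℕ) : Prop :=
  Module.finrank ℂ (Module.End.eigenspace (Matrix.toLin' A) lam) = m ∧
    ∃ (q : ℕ) (μ : Fin q → ℂ) (s : Fin q → ℕ),
      HasJordanForm A μ s ∧ IsLeast {l | ∃ i, μ i = lam ∧ s i = l} k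

/-- `S` is strictly upper triangular with nonzero entries on the superdiagonal. -/
def IsNilpotentParameter {k : ℕ} (S : Matrix (Fin k) (Fin k) ℂ) : Prop :=
  (∀ i j, j ≤ i → S i j = 0) ∧ ∀ i j : Fin k, (i : ℕ) + 1 = j → S i j ≠ 0

/-- The map `(lam, X) ↦ G X - lam X - X S`. -/
def eigMap {n k : ℕ} (S : Matrix (Fin k) (Fin k) ℂ) (G : Matrix (Fin n) (Fin n) ℂ) :
    EigSpace n k → FMat n k :=
  fun x => ofMat (G * toMat x.snd - x.fst • toMat x.snd - toMat x.snd * S)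

/-- The matrices `X` with `A X - lam X - X S = 0`. -/
def eigSolutions {n k : ℕ} (S : Matrix (Fin k) (Fin k) ℂ) (A : Matrix (Fin n) (Fin n) ℂ) (lam : ℂ) :
    Set (FMat n k) :=
  {X | eigMap S A (eigPt lam X) = 0}

/-- The solutions `X` whose first column does not lie in the range of `(A - lam I)^k`. -/
def genericSolutions {n k : ℕ} (S : Matrix (Fin k) (Fin k) ℂ) (A : Matrix (Fin n) (Fin n) ℂ)
    (lam : ℂ) : Set (FMat n k) :=
  {X | X ∈ eigSolutions S A lam ∧
    ∀ j : Fin k, (j : ℕ) = 0 →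
      ¬ ∃ w : Fin n → ℂ, ((A - lam • (1 : Matrix (Fin n) (Fin n) ℂ)) ^ k).mulVec w =
        fun i => toMat X i j}

/-- The norm `‖f_{lam X}(lam, X, A)_{rank-r}^†‖`. -/
noncomputable def eigCond {n k : ℕ} (r : ℕ) (S : Matrix (Fin k) (Fin k) ℂ)
    (A : Matrix (Fin n) (Fin n) ℂ) (lam : ℂ) (X : FMat n k) : ℝ :=
  ‖pinv (rankProj r (fderiv ℂ (eigMap S A) (eigPt lam X)))‖

/-! Write `N = A - lam` and `T X = N X - X S`. At a solution `X` the Jacobian is `(h, Y) ↦ T Y - h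
X`, so its rank is that of `T`, plus one exactly when `X` lies outside the range of `T`. Since `S`
is nilpotent with a cyclic vector `e`, a solution is determined by `v = X e`, and `v` is any vector
with `N ^ k v = 0`. All Jordan blocks at the eigenvalue have size at least `k`, so this kernel has
dimension `m k` and `T` has rank `(n - m) k` (`finrank_ker_eigSylv`). Solving `T Y = X` along the
orbit of `e` leaves the single condition `N ^ k (Y e) = k N ^ (k - 1) v`. As `N ^ (k - 1) v` is a
nonzero multiple of the first column of `X`, the generic solutions are those outside the range of
`T` (`mem_genericSolutions_iff`). They are the complement of a proper subspace of the solutions,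
hence dense.

For the iteration, rank-`r` projections near a map of rank `r` are handled without singular values.
A minimizer `P` must equal its own competitors `P P† L` and `L P† P`, so the residual `L - P` acts
between the orthogonal complements of the coimage and the range of `P`. Its inner product with
another truncation is then of second order, which makes `P`, and hence `P†`, a Lipschitz function of
`L` (`exists_rankProj_lipschitz`).

The map `f` is quadratic, so Newton steps leave a quadratic remainder. The part of `f` missed by the
truncated Jacobian is only multiplied by a small change of the pseudo-inverse. Where `f` is small
the steps are therefore halved, and the iteration converges to a stationary point
(`newtonSeq_converges`), which for perturbed data need not be a zero of `f`. That limit is compared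
with its nearest exact solution: the difference is orthogonal to the kernel of the Jacobian there,
so it is recovered from its image by the pseudo-inverse, and all other errors are of second order
(`norm_sub_solution_le`). -/

set_option linter.unusedSectionVars false

/-! ### The Frobenius inner product and the Moore-Penrose inverse. -/

section PseudoInverse

variable {V W : Type*} [NormedAddCommGroup V] [InnerProductSpace ℂ V] [FiniteDimensional ℂ V]
  [NormedAddCommGroup W] [InnerProductSpace ℂ W] [FiniteDimensional ℂ W]

/-- The Frobenius inner product space in which a linear map is the family of images of an
orthonormal basis. -/
noncomputable def frobVec :
    (V →L[ℂ] W) →ₗ[ℂ] PiLp 2 (fun _ : Fin (Module.finrank ℂ V) => W) where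
  toFun L := WithLp.toLp 2 fun i => L (stdOrthonormalBasis ℂ V i)
  map_add' _ _ := rfl
  map_smul' _ _ := rfl

theorem frobNorm_eq_norm_frobVec (L : V →L[ℂ] W) : frobNorm L = ‖frobVec L‖ := by
  rw [PiLp.norm_eq_of_L2]; rfl

/-- The trace form lets factors be moved across the Frobenius inner product as adjoints, on the left
directly and on the right by cyclicity. -/
theorem inner_frobVec (A B : V →L[ℂ] W) :
    inner ℂ (frobVec A) (frobVec B) =
      LinearMap.trace ℂ V ((A.adjoint ∘L B : V →L[ℂ] V) : V →ₗ[ℂ] V) := by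
  rw [LinearMap.trace_eq_sum_inner _ (stdOrthonormalBasis ℂ V), PiLp.inner_apply]
  refine Finset.sum_congr rfl fun i _ => ?_
  rw [ContinuousLinearMap.coe_coe, ContinuousLinearMap.comp_apply,
    ContinuousLinearMap.adjoint_inner_right]
  rfl

theorem inner_frobVec_comp_left (M : W →L[ℂ] W) (A B : V →L[ℂ] W) :
    inner ℂ (frobVec (M ∘L A)) (frobVec B) =
      inner ℂ (frobVec A) (frobVec (M.adjoint ∘L B)) := by
  rw [inner_frobVec, inner_frobVec, ContinuousLinearMap.adjoint_comp,
    ContinuousLinearMap.comp_assoc]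

theorem inner_frobVec_comp_right (M : V →L[ℂ] V) (A B : V →L[ℂ] W) :
    inner ℂ (frobVec (A ∘L M)) (frobVec B) =
      inner ℂ (frobVec A) (frobVec (B ∘L M.adjoint)) := by
  rw [inner_frobVec, inner_frobVec, ContinuousLinearMap.adjoint_comp]
  exact LinearMap.trace_mul_comm ℂ (M.adjoint : V →ₗ[ℂ] V) ((A.adjoint ∘L B : V →L[ℂ] V) :
    V →ₗ[ℂ] V)

theorem norm_le_frobNorm (L : V →L[ℂ] W) : ‖L‖ ≤ frobNorm L := by
  refine L.opNorm_le_bound (Real.sqrt_nonneg _) fun v => ?_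
  set b := stdOrthonormalBasis ℂ V
  calc ‖L v‖ = ‖∑ i, b.repr v i • L (b i)‖ := by
        conv_lhs => rw [← b.sum_repr v]
        simp
    _ ≤ ∑ i, ‖b.repr v i‖ * ‖L (b i)‖ := by
        refine (norm_sum_le _ _).trans_eq ?_
        simp [norm_smul]
    _ ≤ Real.sqrt (∑ i, ‖b.repr v i‖ ^ 2) * Real.sqrt (∑ i, ‖L (b i)‖ ^ 2) :=
        Real.sum_mul_le_sqrt_mul_sqrt _ _ _
    _ = frobNorm L * ‖v‖ := by
        rw [← EuclideanSpace.norm_eq, b.repr.norm_map, mul_comm]; rfl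

theorem frobNorm_le_norm (L : V →L[ℂ] W) :
    frobNorm L ≤ Real.sqrt (Module.finrank ℂ V) * ‖L‖ := by
  rw [frobNorm, ← Real.sqrt_sq (norm_nonneg L), ← Real.sqrt_mul (Nat.cast_nonneg _)]
  refine Real.sqrt_le_sqrt ?_
  calc ∑ i, ‖L (stdOrthonormalBasis ℂ V i)‖ ^ 2
      ≤ ∑ _i : Fin (Module.finrank ℂ V), ‖L‖ ^ 2 := by
        refine Finset.sum_le_sum fun i _ => ?_
        gcongr
        refine (L.le_opNorm _).trans_eq ?_
        rw [(stdOrthonormalBasis ℂ V).orthonormal.1 i, mul_one]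
    _ = _ := by simp

theorem frobVec_injective : Function.Injective (frobVec (V := V) (W := W)) := by
  rw [injective_iff_map_eq_zero]
  intro L hL
  have := norm_le_frobNorm L
  rw [frobNorm_eq_norm_frobVec, hL, norm_zero] at this
  exact norm_le_zero_iff.mp this

theorem continuous_frobNorm : Continuous (frobNorm (V := V) (W := W)) := by
  have : (frobNorm (V := V) (W := W)) = fun L => ‖frobVec L‖ :=
    funext frobNorm_eq_norm_frobVec
  rw [this]
  exact (LinearMap.continuous_of_finiteDimensional _).norm

theorem pinv_mem (L : V →L[ℂ] W) (w : W) : pinv L w ∈ (LinearMap.ker (L : V →ₗ[ℂ] W))ᗮ := by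
  simp [pinv]

theorem apply_pinv (L : V →L[ℂ] W) (w : W) :
    L (pinv L w) = (LinearMap.range (L : V →ₗ[ℂ] W)).starProjection w := by
  set e := LinearMap.kerComplementEquivRange (L : V →ₗ[ℂ] W)
        (LinearMap.ker (L : V →ₗ[ℂ] W)).isCompl_orthogonal.symm with he
  have h : ∀ u, L ((e.symm u : (LinearMap.ker (L : V →ₗ[ℂ] W))ᗮ) : V) = (u : W) := fun u =>
    congrArg Subtype.val (e.apply_symm_apply u)
  exact h _

theorem apply_pinv_apply (L : V →L[ℂ] W) (v : V) : L (pinv L (L v)) = L v := by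
  rw [apply_pinv]
  exact Submodule.starProjection_eq_self_iff.mpr ⟨v, rfl⟩

theorem pinv_apply (L : V →L[ℂ] W) (v : V) :
    pinv L (L v) = (LinearMap.ker (L : V →ₗ[ℂ] W))ᗮ.starProjection v := by
  set K := LinearMap.ker (L : V →ₗ[ℂ] W)
  have h1 : pinv L (L v) - v ∈ K := by
    rw [LinearMap.mem_ker]
    simp only [map_sub, ContinuousLinearMap.coe_coe]
    rw [apply_pinv_apply, sub_self]
  refine (Submodule.eq_starProjection_of_mem_of_inner_eq_zero (pinv_mem L _) ?_).symm
  intro u hu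
  rw [← neg_sub, inner_neg_left, (Submodule.mem_orthogonal _ _).mp hu _ h1, neg_zero]

theorem sub_apply_pinv (L : V →L[ℂ] W) (w : W) :
    w - L (pinv L w) = (LinearMap.range (L : V →ₗ[ℂ] W))ᗮ.starProjection w := by
  rw [apply_pinv, Submodule.starProjection_orthogonal]; rfl

theorem sub_pinv_apply (L : V →L[ℂ] W) (v : V) :
    v - pinv L (L v) = (LinearMap.ker (L : V →ₗ[ℂ] W)).starProjection v := by
  rw [pinv_apply, Submodule.starProjection_orthogonal]; simp

theorem pinv_apply_pinv (L : V →L[ℂ] W) (w : W) : pinv L (L (pinv L w)) = pinv L w := by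
  rw [pinv_apply]
  exact Submodule.starProjection_eq_self_iff.mpr (pinv_mem L w)

theorem inner_apply_pinv (L : V →L[ℂ] W) (w w' : W) :
    inner ℂ (L (pinv L w)) w' = inner ℂ w (L (pinv L w')) := by
  rw [apply_pinv, apply_pinv]
  exact Submodule.inner_starProjection_left_eq_right _ _ _

theorem inner_pinv_apply (L : V →L[ℂ] W) (v v' : V) :
    inner ℂ (pinv L (L v)) v' = inner ℂ v (pinv L (L v')) := by
  rw [pinv_apply, pinv_apply]
  exact Submodule.inner_starProjection_left_eq_right _ _ _

theorem norm_sub_apply_pinv_le (L : V →L[ℂ] W) (w : W) : ‖w - L (pinv L w)‖ ≤ ‖w‖ := by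
  rw [sub_apply_pinv]
  exact Submodule.norm_starProjection_apply_le _ _

/-- The Moore-Penrose inverse is Lipschitz as long as it is bounded. -/
theorem norm_pinv_sub_pinv_le (P₁ P₂ : V →L[ℂ] W) :
    ‖pinv P₂ - pinv P₁‖ ≤
      (‖pinv P₂‖ * ‖pinv P₁‖ + ‖pinv P₂‖ ^ 2 + ‖pinv P₁‖ ^ 2) * ‖P₂ - P₁‖ := by
  refine ContinuousLinearMap.opNorm_le_bound _ (by positivity) fun w => ?_
  set Q₁ := pinv P₁ with hQ₁
  set Q₂ := pinv P₂ with hQ₂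
  set D := P₂ - P₁ with hD
  set a := w - P₁ (Q₁ w) with ha
  set c := Q₁ w - Q₂ (P₂ (Q₁ w)) with hc
  -- This is the identity `Q₂ - Q₁ = -Q₂ (P₂ - P₁) Q₁ + Q₂ (1 - P₁ Q₁) - (1 - Q₂ P₂) Q₁`. Each of
  -- the last two terms contains a product of two projections that would vanish if `P₁ = P₂`.
  have hsplit : (Q₂ - Q₁) w = -Q₂ (D (Q₁ w)) + Q₂ a - c := by
    simp only [ha, hc, hD, sub_apply, map_sub]
    abel
  have hanorm : ‖a‖ ≤ ‖w‖ := norm_sub_apply_pinv_le P₁ w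
  -- The vector `a` is orthogonal to the range of `P₁`, so its projection to the range of `P₂` only
  -- sees `D`.
  have hπ : ‖P₂ (Q₂ a)‖ ≤ ‖D‖ * ‖Q₂‖ * ‖a‖ := by
    set p := P₂ (Q₂ a) with hp
    rcases (norm_nonneg p).eq_or_lt with h0 | h0
    · rw [← h0]; positivity
    have h1 : inner ℂ p p = inner ℂ (D (Q₂ p)) a := by
      have h2 : inner ℂ (P₁ (Q₂ p)) a = 0 := by
        rw [ha, inner_sub_right, ← inner_apply_pinv, apply_pinv_apply, sub_self]
      rw [hD, sub_apply, inner_sub_left, h2, sub_zero]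
      exact (inner_apply_pinv P₂ p a).symm
    have h3 : ‖p‖ ^ 2 ≤ ‖D‖ * (‖Q₂‖ * ‖p‖) * ‖a‖ := by
      calc ‖p‖ ^ 2 = ‖inner ℂ p p‖ := by rw [inner_self_eq_norm_sq_to_K]; simp
        _ ≤ ‖D (Q₂ p)‖ * ‖a‖ := by rw [h1]; exact norm_inner_le_norm _ _
        _ ≤ _ := by
          gcongr
          exact (D.le_opNorm _).trans (by gcongr; exact Q₂.le_opNorm _)
    nlinarith
  -- Dually, `c` is the projection of `Q₁ w` to the kernel of `P₂`, while `Q₁ w` lies in the coimage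
  -- of `P₁`; on that kernel `P₁` agrees with `-D`.
  have hcn : ‖c‖ ≤ ‖Q₁‖ * ‖D‖ * ‖Q₁ w‖ := by
    rcases (norm_nonneg c).eq_or_lt with h0 | h0
    · rw [← h0]; positivity
    have hPc : P₂ c = 0 := by rw [hc, map_sub, apply_pinv_apply, sub_self]
    have h1 : inner ℂ c c = inner ℂ (Q₁ (P₁ c)) (Q₁ w) := by
      rw [inner_pinv_apply, pinv_apply_pinv]
      conv_lhs => rw [hc, inner_sub_right, ← inner_pinv_apply, ← hc, hPc]
      simp
      rfl
    have h2 : Q₁ (P₁ c) = -Q₁ (D c) := by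
      simp [hD, hPc]
    have h3 : ‖c‖ ^ 2 ≤ ‖Q₁‖ * (‖D‖ * ‖c‖) * ‖Q₁ w‖ := by
      calc ‖c‖ ^ 2 = ‖inner ℂ c c‖ := by rw [inner_self_eq_norm_sq_to_K]; simp
        _ ≤ ‖Q₁ (D c)‖ * ‖Q₁ w‖ := by
          rw [h1, h2, inner_neg_left, norm_neg]; exact norm_inner_le_norm _ _
        _ ≤ _ := by
          gcongr
          exact (Q₁.le_opNorm _).trans (by gcongr; exact D.le_opNorm _)
    nlinarith
  have hQ2a : ‖Q₂ a‖ ≤ ‖Q₂‖ * (‖D‖ * ‖Q₂‖ * ‖w‖) := by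
    rw [hQ₂, ← pinv_apply_pinv, ← hQ₂]
    exact (Q₂.le_opNorm _).trans (by gcongr; exact hπ.trans (by gcongr))
  have hfirst : ‖Q₂ (D (Q₁ w))‖ ≤ ‖Q₂‖ * (‖D‖ * (‖Q₁‖ * ‖w‖)) :=
    (Q₂.le_opNorm _).trans (by
      gcongr; exact (D.le_opNorm _).trans (by gcongr; exact Q₁.le_opNorm _))
  have hc' : ‖c‖ ≤ ‖Q₁‖ * ‖D‖ * (‖Q₁‖ * ‖w‖) := hcn.trans (by gcongr; exact Q₁.le_opNorm _)
  rw [hsplit]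
  calc _ ≤ ‖Q₂ (D (Q₁ w))‖ + ‖Q₂ a‖ + ‖c‖ := by
        refine (norm_sub_le _ _).trans ?_
        gcongr
        refine (norm_add_le _ _).trans ?_
        rw [norm_neg]
    _ ≤ _ := by nlinarith

/-- The rank does not drop under small perturbations, and the Moore-Penrose inverse stays bounded
where the rank is kept. -/
theorem exists_rank_le_and_pinv_le (L₀ : V →L[ℂ] W) :
    ∃ c : ℝ, 0 < c ∧ ∀ P : V →L[ℂ] W, ‖P - L₀‖ < c → mapRank L₀ ≤ mapRank P ∧
      (mapRank P = mapRank L₀ → ‖pinv P‖ ≤ c⁻¹) := by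
  set U := (LinearMap.ker (L₀ : V →ₗ[ℂ] W))ᗮ with hU
  have hUdim : Module.finrank ℂ U = mapRank L₀ :=
    LinearEquiv.finrank_eq (LinearMap.kerComplementEquivRange (L₀ : V →ₗ[ℂ] W)
      (LinearMap.ker (L₀ : V →ₗ[ℂ] W)).isCompl_orthogonal.symm)
  have hinj : Function.Injective ((L₀ : V →ₗ[ℂ] W) ∘ₗ U.subtype) := by
    rw [injective_iff_map_eq_zero]
    rintro ⟨u, hu⟩ h
    have hk : u ∈ LinearMap.ker (L₀ : V →ₗ[ℂ] W) := h
    have := (Submodule.mem_orthogonal _ _).mp hu u hk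
    exact Subtype.ext (inner_self_eq_zero.mp this)
  obtain ⟨K, hK, hanti⟩ := (LinearMap.injective_iff_antilipschitz _).mp hinj
  have hK' : (0 : ℝ) < K := hK
  have hbound : ∀ u ∈ U, ‖u‖ ≤ K * ‖L₀ u‖ := fun u hu => by
    simpa using hanti.le_mul_dist (⟨u, hu⟩ : U) 0
  -- On the coimage `U` of `L₀` the lower bound is `1 / K`; a perturbation below half of it leaves
  -- `1 / (2 K)`.
  refine ⟨(2 * (K : ℝ))⁻¹, by positivity, fun P hP => ?_⟩
  have hPb : ∀ u ∈ U, ‖u‖ ≤ 2 * K * ‖P u‖ := by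
    intro u hu
    have h1 : ‖L₀ u‖ ≤ ‖P u‖ + (2 * (K : ℝ))⁻¹ * ‖u‖ := by
      calc ‖L₀ u‖ = ‖P u - (P - L₀) u‖ := by simp
        _ ≤ ‖P u‖ + ‖(P - L₀) u‖ := norm_sub_le _ _
        _ ≤ _ := by
          gcongr
          exact ((P - L₀).le_opNorm u).trans (by gcongr)
    have h2 := (hbound u hu).trans (mul_le_mul_of_nonneg_left h1 hK'.le)
    have h3 : (K : ℝ) * ((2 * (K : ℝ))⁻¹ * ‖u‖) = ‖u‖ / 2 := by field_simp
    rw [mul_add, h3] at h2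
    linarith
  have hPinj : Function.Injective ((P : V →ₗ[ℂ] W) ∘ₗ U.subtype) := by
    rw [injective_iff_map_eq_zero]
    rintro ⟨u, hu⟩ h
    have h0 : P u = 0 := h
    have := hPb u hu
    rw [h0, norm_zero, mul_zero] at this
    exact Subtype.ext (norm_le_zero_iff.mp this)
  have hrange : LinearMap.range ((P : V →ₗ[ℂ] W) ∘ₗ U.subtype) ≤
      LinearMap.range (P : V →ₗ[ℂ] W) := LinearMap.range_comp_le_range _ _
  have hdim := LinearMap.finrank_range_of_inj hPinj
  rw [hUdim] at hdim
  refine ⟨?_, fun hr => ?_⟩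
  · rw [← hdim]
    exact Submodule.finrank_mono hrange
  -- With equal ranks, `P` already attains its whole range on `U`. The Moore-Penrose preimage is the
  -- shortest one, so it is bounded by a preimage in `U`.
  · have heq := Submodule.eq_of_le_of_finrank_eq hrange (hdim.trans hr.symm)
    rw [inv_inv]
    refine ContinuousLinearMap.opNorm_le_bound _ (by positivity) fun w => ?_
    have hw : P (pinv P w) ∈ LinearMap.range ((P : V →ₗ[ℂ] W) ∘ₗ U.subtype) := by
      rw [heq]; exact ⟨_, rfl⟩
    obtain ⟨⟨u, hu⟩, hu'⟩ := hw
    have hu'' : P u = P (pinv P w) := hu'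
    calc ‖pinv P w‖ = ‖pinv P (P u)‖ := by rw [hu'', pinv_apply_pinv]
      _ ≤ ‖u‖ := by rw [pinv_apply]; exact Submodule.norm_starProjection_apply_le _ _
      _ ≤ 2 * K * ‖P u‖ := hPb u hu
      _ ≤ 2 * K * ‖w‖ := by
        gcongr
        rw [hu'', apply_pinv]; exact Submodule.norm_starProjection_apply_le _ _

end PseudoInverse

/-! ### Existence, uniqueness and Lipschitz dependence of rank-`r` projections. -/

section RankProjectionLocal

variable {V W : Type*} [NormedAddCommGroup V] [InnerProductSpace ℂ V] [FiniteDimensional ℂ V]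
  [NormedAddCommGroup W] [InnerProductSpace ℂ W] [FiniteDimensional ℂ W]

theorem mapRank_comp_left_le (M : W →L[ℂ] W) (P : V →L[ℂ] W) : mapRank (M ∘L P) ≤ mapRank P := by
  have : LinearMap.range ((M ∘L P : V →L[ℂ] W) : V →ₗ[ℂ] W) =
      (LinearMap.range (P : V →ₗ[ℂ] W)).map (M : W →ₗ[ℂ] W) := LinearMap.range_comp _ _
  rw [mapRank, this]
  exact Submodule.finrank_map_le _ _

theorem adjoint_comp_pinv (P : V →L[ℂ] W) : (P ∘L pinv P).adjoint = P ∘L pinv P :=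
  ((ContinuousLinearMap.eq_adjoint_iff _ _).mpr (inner_apply_pinv P)).symm

theorem adjoint_pinv_comp (P : V →L[ℂ] W) : (pinv P ∘L P).adjoint = pinv P ∘L P :=
  ((ContinuousLinearMap.eq_adjoint_iff _ _).mpr (inner_pinv_apply P)).symm

theorem adjoint_one_sub_comp_pinv (P : V →L[ℂ] W) :
    (1 - P ∘L pinv P).adjoint = 1 - P ∘L pinv P := by
  rw [map_sub, adjoint_comp_pinv]
  congr 1
  exact ContinuousLinearMap.adjoint_id

theorem adjoint_one_sub_pinv_comp (P : V →L[ℂ] W) :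
    (1 - pinv P ∘L P).adjoint = 1 - pinv P ∘L P := by
  rw [map_sub, adjoint_pinv_comp]
  congr 1
  exact ContinuousLinearMap.adjoint_id

theorem frobNorm_sub_comm (A B : V →L[ℂ] W) : frobNorm (A - B) = frobNorm (B - A) := by
  rw [frobNorm_eq_norm_frobVec, frobNorm_eq_norm_frobVec, map_sub, map_sub, norm_sub_rev]

theorem frobNorm_sub_le (A B C : V →L[ℂ] W) :
    frobNorm (A - C) ≤ frobNorm (A - B) + frobNorm (B - C) := by
  simp only [frobNorm_eq_norm_frobVec, map_sub]
  exact norm_sub_le_norm_sub_add_norm_sub _ _ _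

theorem frobNorm_sq_of_inner_eq_zero {L P P' : V →L[ℂ] W}
    (h : inner ℂ (frobVec (L - P')) (frobVec (P' - P)) = 0) :
    frobNorm (L - P) ^ 2 = frobNorm (L - P') ^ 2 + frobNorm (P' - P) ^ 2 := by
  have h1 : frobVec (L - P) = frobVec (L - P') + frobVec (P' - P) := by
    rw [← map_add]; congr 1; abel
  have := norm_add_sq_eq_norm_sq_add_norm_sq_of_inner_eq_zero _ _ h
  simp only [frobNorm_eq_norm_frobVec, h1]
  simpa [sq] using this

/-- By Pythagoras the projected competitor `P'` is strictly closer to `L` unless it is `P`; this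
turns minimality into algebraic identities. -/
theorem eq_of_frobNorm_le_of_inner_eq_zero {L P P' : V →L[ℂ] W}
    (h : inner ℂ (frobVec (L - P')) (frobVec (P' - P)) = 0)
    (hle : frobNorm (L - P) ≤ frobNorm (L - P')) : P' = P := by
  have h1 := frobNorm_sq_of_inner_eq_zero h
  have h2 : frobNorm (P' - P) = 0 := by
    have h0 : 0 ≤ frobNorm (L - P) := Real.sqrt_nonneg _
    have : frobNorm (L - P) ^ 2 ≤ frobNorm (L - P') ^ 2 := by gcongr
    nlinarith [sq_nonneg (frobNorm (P' - P))]
  rw [frobNorm_eq_norm_frobVec, norm_eq_zero] at h2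
  exact sub_eq_zero.mp (frobVec_injective (h2.trans (map_zero _).symm))

theorem frobNorm_le_of_inner_eq_zero {L P P' : V →L[ℂ] W}
    (h : inner ℂ (frobVec (L - P')) (frobVec (P' - P)) = 0) :
    frobNorm (L - P') ≤ frobNorm (L - P) := by
  have h1 := frobNorm_sq_of_inner_eq_zero h
  exact le_of_sq_le_sq (by nlinarith [sq_nonneg (frobNorm (P' - P))]) (Real.sqrt_nonneg _)

theorem inner_frobVec_sub_range_proj (L P : V →L[ℂ] W) :
    inner ℂ (frobVec (L - (P ∘L pinv P) ∘L L)) (frobVec ((P ∘L pinv P) ∘L L - P)) = 0 := by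
  have h1 : (P ∘L pinv P) ∘L L - P = (P ∘L pinv P) ∘L (L - P) := by
    ext v; simp [apply_pinv_apply]
  have h2 : (P ∘L pinv P) ∘L (L - (P ∘L pinv P) ∘L L) = 0 := by
    ext v; simp [apply_pinv_apply]
  conv_lhs => rw [h1, ← adjoint_comp_pinv, ← inner_frobVec_comp_left, adjoint_comp_pinv, h2]
  simp

theorem inner_frobVec_sub_ker_proj (L P : V →L[ℂ] W) :
    inner ℂ (frobVec (L - L ∘L (pinv P ∘L P))) (frobVec (L ∘L (pinv P ∘L P) - P)) = 0 := by
  have h1 : L ∘L (pinv P ∘L P) - P = (L - P) ∘L (pinv P ∘L P) := by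
    ext v; simp [apply_pinv_apply]
  have h2 : (L - L ∘L (pinv P ∘L P)) ∘L (pinv P ∘L P) = 0 := by
    ext v; simp [apply_pinv_apply]
  conv_lhs => rw [h1, ← adjoint_pinv_comp, ← inner_frobVec_comp_right, adjoint_pinv_comp, h2]
  simp

/-- `P` is compatible with `L`: it is both a compression of `L` to the range of `P` and the
restriction of `L` to the coimage of `P`. -/
structure IsSingularTruncation (L P : V →L[ℂ] W) : Prop where
  left : ∀ v, P (pinv P (L v)) = P v
  right : ∀ v, L (pinv P (P v)) = P v

theorem IsSingularTruncation.pinv_apply_pinv {L P : V →L[ℂ] W} (h : IsSingularTruncation L P)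
    (w : W) : pinv P (L (pinv P w)) = pinv P w := by
  rw [← _root_.pinv_apply_pinv P w, h.right]

theorem IsSingularTruncation.norm_sub_apply_pinv_le {L P : V →L[ℂ] W}
    (h : IsSingularTruncation L P) (w : W) : ‖w - L (pinv P w)‖ ≤ ‖w‖ := by
  rw [← _root_.pinv_apply_pinv P w, h.right]
  exact _root_.norm_sub_apply_pinv_le P w

/-- The residual vanishes on the coimage of `P` and takes values orthogonal to its range, so
compressing it to these complements changes nothing. -/
theorem IsSingularTruncation.residual_eq {L P : V →L[ℂ] W} (h : IsSingularTruncation L P) :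
    L - P = (1 - P ∘L pinv P) ∘L ((L - P) ∘L (1 - pinv P ∘L P)) := by
  ext v
  simp [h.left, h.right, apply_pinv_apply]

theorem norm_one_sub_comp_pinv_le (P : V →L[ℂ] W) : ‖1 - P ∘L pinv P‖ ≤ 1 :=
  ContinuousLinearMap.opNorm_le_bound _ zero_le_one fun w => by
    rw [one_mul]; exact norm_sub_apply_pinv_le P w

theorem norm_one_sub_pinv_comp_le (P : V →L[ℂ] W) : ‖1 - pinv P ∘L P‖ ≤ 1 :=
  ContinuousLinearMap.opNorm_le_bound _ zero_le_one fun v => by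
    rw [one_mul]
    change ‖v - pinv P (P v)‖ ≤ ‖v‖
    rw [sub_pinv_apply]
    exact Submodule.norm_starProjection_apply_le _ _

/-- Only the compression `a P₂ b` to the complements for `P₁` meets the residual. Inserting `P₂ = P₂
P₂† P₂` and using `a P₁ = 0` and `P₁ b = 0` gives `a D P₂† D b`, which is quadratic in `D = P₂ -
P₁`. -/
theorem IsSingularTruncation.norm_inner_residual_le {L₁ P₁ : V →L[ℂ] W}
    (h : IsSingularTruncation L₁ P₁) (P₂ : V →L[ℂ] W) :
    ‖inner ℂ (frobVec (L₁ - P₁)) (frobVec P₂)‖ ≤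
      frobNorm (L₁ - P₁) * (Real.sqrt (Module.finrank ℂ V) * ‖pinv P₂‖) *
        frobNorm (P₂ - P₁) ^ 2 := by
  set a := 1 - P₁ ∘L pinv P₁ with ha
  set b := 1 - pinv P₁ ∘L P₁ with hb
  set D := P₂ - P₁ with hD
  have h1 : inner ℂ (frobVec (L₁ - P₁)) (frobVec P₂) =
      inner ℂ (frobVec (L₁ - P₁)) (frobVec ((a ∘L P₂) ∘L b)) := by
    conv_lhs => rw [h.residual_eq]
    rw [inner_frobVec_comp_left, adjoint_one_sub_comp_pinv, inner_frobVec_comp_right,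
      adjoint_one_sub_pinv_comp]
  have h2 : (a ∘L P₂) ∘L b = (a ∘L D) ∘L (pinv P₂ ∘L (D ∘L b)) := by
    have e1 : a ∘L D = a ∘L P₂ := by
      ext v; simp [ha, hD, apply_pinv_apply]
    have e2 : D ∘L b = P₂ ∘L b := by
      ext v; simp [hb, hD, apply_pinv_apply]
    rw [e1, e2]
    ext v
    simp [apply_pinv_apply]
  have h3 : ‖(a ∘L D) ∘L (pinv P₂ ∘L (D ∘L b))‖ ≤ (1 * ‖D‖) * (‖pinv P₂‖ * (‖D‖ * 1)) := by
    refine (ContinuousLinearMap.opNorm_comp_le _ _).trans ?_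
    gcongr
    · exact (ContinuousLinearMap.opNorm_comp_le _ _).trans
        (by gcongr; exact norm_one_sub_comp_pinv_le P₁)
    · refine (ContinuousLinearMap.opNorm_comp_le _ _).trans ?_
      gcongr
      exact (ContinuousLinearMap.opNorm_comp_le _ _).trans
        (by gcongr; exact norm_one_sub_pinv_comp_le P₁)
  rw [h1, h2]
  refine (norm_inner_le_norm _ _).trans ?_
  rw [← frobNorm_eq_norm_frobVec, ← frobNorm_eq_norm_frobVec, mul_assoc]
  have h0 : 0 ≤ frobNorm (L₁ - P₁) := Real.sqrt_nonneg _
  refine mul_le_mul_of_nonneg_left ?_ h0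
  refine (frobNorm_le_norm _).trans ?_
  rw [mul_assoc]
  refine mul_le_mul_of_nonneg_left (h3.trans ?_) (Real.sqrt_nonneg _)
  have h4 : ‖D‖ ^ 2 ≤ frobNorm D ^ 2 := by gcongr; exact norm_le_frobNorm D
  nlinarith [norm_nonneg (pinv P₂)]

/-- Truncations with small residuals depend on the map in a Lipschitz way. -/
theorem IsSingularTruncation.frobNorm_sub_le {L₁ P₁ L₂ P₂ : V →L[ℂ] W}
    (h₁ : IsSingularTruncation L₁ P₁) (h₂ : IsSingularTruncation L₂ P₂)
    (hs₁ : frobNorm (L₁ - P₁) * (Real.sqrt (Module.finrank ℂ V) * ‖pinv P₂‖) ≤ 1 / 4)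
    (hs₂ : frobNorm (L₂ - P₂) * (Real.sqrt (Module.finrank ℂ V) * ‖pinv P₁‖) ≤ 1 / 4) :
    frobNorm (P₂ - P₁) ≤ 2 * frobNorm (L₂ - L₁) := by
  have e0 : ∀ A : V →L[ℂ] W, frobNorm (A - A) = 0 := fun A => by
    rw [frobNorm_eq_norm_frobVec, sub_self, map_zero, norm_zero]
  have e11 := h₁.norm_inner_residual_le P₁
  have e12 := h₁.norm_inner_residual_le P₂
  have e21 := h₂.norm_inner_residual_le P₁
  have e22 := h₂.norm_inner_residual_le P₂
  -- Comparing a truncation with itself gives `D = 0`, so each residual is orthogonal to its own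
  -- truncation.
  rw [e0, sq, mul_zero, mul_zero] at e11 e22
  rw [frobNorm_sub_comm P₁ P₂] at e21
  have e12' := e12.trans (mul_le_mul_of_nonneg_right hs₁ (sq_nonneg _))
  have e21' := e21.trans (mul_le_mul_of_nonneg_right hs₂ (sq_nonneg _))
  set x := frobVec (P₂ - P₁) with hx
  set y := frobVec (L₂ - L₁) with hy
  simp only [frobNorm_eq_norm_frobVec] at e12' e21' ⊢
  rw [← hx] at e12' e21'
  rw [← hx, ← hy]
  have hsplit : x = y - frobVec (L₂ - P₂) + frobVec (L₁ - P₁) := by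
    rw [hx, hy]; simp only [map_sub]; abel
  have hin : inner ℂ x x = inner ℂ y x - inner ℂ (frobVec (L₂ - P₂)) (frobVec P₂)
      + inner ℂ (frobVec (L₂ - P₂)) (frobVec P₁) + inner ℂ (frobVec (L₁ - P₁)) (frobVec P₂)
      - inner ℂ (frobVec (L₁ - P₁)) (frobVec P₁) := by
    conv_lhs => arg 2; rw [hsplit]
    rw [inner_add_left, inner_sub_left, hx, map_sub frobVec P₂ P₁, inner_sub_right, inner_sub_right,
      inner_sub_right]
    ring
  have hn : ‖x‖ ^ 2 ≤ ‖y‖ * ‖x‖ + 1 / 4 * ‖x‖ ^ 2 + 1 / 4 * ‖x‖ ^ 2 := by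
    calc ‖x‖ ^ 2 = ‖inner ℂ x x‖ := by rw [inner_self_eq_norm_sq_to_K]; simp
      _ ≤ ‖inner ℂ y x‖ + ‖inner ℂ (frobVec (L₂ - P₂)) (frobVec P₂)‖
          + ‖inner ℂ (frobVec (L₂ - P₂)) (frobVec P₁)‖
          + ‖inner ℂ (frobVec (L₁ - P₁)) (frobVec P₂)‖
          + ‖inner ℂ (frobVec (L₁ - P₁)) (frobVec P₁)‖ := by
        rw [hin]
        refine (norm_sub_le _ _).trans ?_
        gcongr
        refine (norm_add_le _ _).trans ?_
        gcongr
        refine (norm_add_le _ _).trans ?_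
        gcongr
        exact norm_sub_le _ _
      _ ≤ _ := by
        have := norm_inner_le_norm (𝕜 := ℂ) y x
        linarith
  rcases (norm_nonneg x).eq_or_lt with h0 | h0
  · rw [← h0]; positivity
  · nlinarith

/-- Rank is lower semicontinuous. The minimization is carried out over rank at most `r`, since rank
exactly `r` is not a closed condition. -/
theorem mapRank_le_isClosed (r : ℕ) : IsClosed {P : V →L[ℂ] W | mapRank P ≤ r} := by
  rw [← isOpen_compl_iff, Metric.isOpen_iff]
  intro P hP
  obtain ⟨c, hc, h⟩ := exists_rank_le_and_pinv_le P
  refine ⟨c, hc, fun Q hQ => ?_⟩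
  rw [Metric.mem_ball, dist_eq_norm] at hQ
  have := (h Q hQ).1
  simp only [Set.mem_compl_iff, Set.mem_ofPred_eq] at hP ⊢
  omega

theorem rankProj_isRankProj {r : ℕ} {L : V →L[ℂ] W} (h : ∃ P, IsRankProj r L P) :
    IsRankProj r L (rankProj r L) := by
  rw [rankProj, dif_pos h]
  exact h.choose_spec

theorem IsRankProj.eq_of_mapRank {r : ℕ} {L P : V →L[ℂ] W} (hL : mapRank L = r)
    (h : IsRankProj r L P) : P = L := by
  have h1 := h.2 L hL
  rw [frobNorm_eq_norm_frobVec, frobNorm_eq_norm_frobVec, sub_self, map_zero, norm_zero] at h1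
  have h2 := norm_le_zero_iff.mp h1
  exact (sub_eq_zero.mp (frobVec_injective (h2.trans (map_zero _).symm))).symm

theorem isRankProj_self {r : ℕ} {L : V →L[ℂ] W} (hL : mapRank L = r) : IsRankProj r L L := by
  refine ⟨hL, fun Q _ => ?_⟩
  rw [frobNorm_eq_norm_frobVec, sub_self, map_zero, norm_zero]
  exact Real.sqrt_nonneg _

theorem rankProj_of_mapRank {r : ℕ} {L : V →L[ℂ] W} (hL : mapRank L = r) : rankProj r L = L :=
  (rankProj_isRankProj ⟨L, isRankProj_self hL⟩).eq_of_mapRank hL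

/-- Near a map of rank `r`, rank-`r` projections exist, are unique, and their Moore-Penrose inverses
are bounded and depend on the map in a Lipschitz way. -/
theorem exists_rankProj_lipschitz (L₀ : V →L[ℂ] W) {r : ℕ} (hr : mapRank L₀ = r) :
    ∃ ρ M Λ : ℝ, 0 < ρ ∧ 0 ≤ M ∧ 0 ≤ Λ ∧ ∀ L : V →L[ℂ] W, ‖L - L₀‖ < ρ →
      (∃! P, IsRankProj r L P) ∧ ‖pinv (rankProj r L)‖ ≤ M ∧
      (∀ w, pinv (rankProj r L) (L (pinv (rankProj r L) w)) = pinv (rankProj r L) w) ∧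
      (∀ w, ‖w - L (pinv (rankProj r L) w)‖ ≤ ‖w‖) ∧
      ∀ L' : V →L[ℂ] W, ‖L' - L₀‖ < ρ →
        ‖pinv (rankProj r L') - pinv (rankProj r L)‖ ≤ Λ * ‖L' - L‖ := by
  obtain ⟨c, hc, hrank⟩ := exists_rank_le_and_pinv_le L₀
  rw [hr] at hrank
  set s := Real.sqrt (Module.finrank ℂ V) with hs
  have hs0 : 0 ≤ s := Real.sqrt_nonneg _
  set ρ := c / (4 * (s + 1) ^ 2) with hρ
  have hρ0 : 0 < ρ := by positivity
  have hρ1 : 2 * (s * ρ) < c := by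
    rw [hρ, ← mul_div_assoc, ← mul_div_assoc, div_lt_iff₀ (by positivity)]
    have : 0 ≤ s * c := by positivity
    nlinarith [mul_nonneg this hs0]
  have hρ2 : s * ρ * (s * c⁻¹) ≤ 1 / 4 := by
    rw [hρ]
    have : s * (c / (4 * (s + 1) ^ 2)) * (s * c⁻¹) = s ^ 2 / (4 * (s + 1) ^ 2) := by
      field_simp
    rw [this, div_le_div_iff₀ (by positivity) (by norm_num)]
    nlinarith
  have hF : ∀ L : V →L[ℂ] W, ‖L - L₀‖ < ρ → frobNorm (L - L₀) ≤ s * ρ := fun L hL =>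
    (frobNorm_le_norm _).trans (by gcongr)
  have hnear : ∀ L P : V →L[ℂ] W, ‖L - L₀‖ < ρ → frobNorm (L - P) ≤ frobNorm (L - L₀) →
      ‖P - L₀‖ < c := by
    intro L P hL hP
    have h1 := frobNorm_sub_le P L L₀
    have h2 := norm_le_frobNorm (P - L₀)
    rw [frobNorm_sub_comm P L] at h1
    have h3 := hF L hL
    linarith
  have hcrit : ∀ L P : V →L[ℂ] W, ‖L - L₀‖ < ρ → IsRankProj r L P →
      IsSingularTruncation L P ∧ ‖pinv P‖ ≤ c⁻¹ ∧ frobNorm (L - P) ≤ s * ρ := by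
    intro L P hL hP
    have hPL := hP.2 L₀ hr
    refine ⟨?_, (hrank P (hnear L P hL hPL)).2 hP.1, hPL.trans (hF L hL)⟩
    -- The projected map `P'` is no farther from `L` than `P`, hence still near `L₀`, where the rank
    -- cannot fall below `r`. It is therefore an admissible competitor and must equal the minimizer
    -- `P`.
    have key : ∀ P' : V →L[ℂ] W, mapRank P' ≤ mapRank P →
        inner ℂ (frobVec (L - P')) (frobVec (P' - P)) = 0 → P' = P := by
      intro P' h1 h2
      refine eq_of_frobNorm_le_of_inner_eq_zero h2 (hP.2 P' (le_antisymm (h1.trans_eq hP.1) ?_))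
      exact (hrank P' (hnear L P' hL ((frobNorm_le_of_inner_eq_zero h2).trans hPL))).1
    constructor
    · intro v
      have hle : mapRank ((P ∘L pinv P) ∘L L) ≤ mapRank P := by
        rw [ContinuousLinearMap.comp_assoc]
        exact Submodule.finrank_mono
          (LinearMap.range_comp_le_range ((pinv P ∘L L : V →L[ℂ] V) : V →ₗ[ℂ] V) (P : V →ₗ[ℂ] W))
      exact congrArg (fun T : V →L[ℂ] W => T v) (key _ hle (inner_frobVec_sub_range_proj L P))
    · intro v
      have hle : mapRank (L ∘L (pinv P ∘L P)) ≤ mapRank P := by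
        rw [← ContinuousLinearMap.comp_assoc]
        exact mapRank_comp_left_le (L ∘L pinv P) P
      exact congrArg (fun T : V →L[ℂ] W => T v) (key _ hle (inner_frobVec_sub_ker_proj L P))
  have hlip : ∀ L₁ P₁ L₂ P₂ : V →L[ℂ] W, ‖L₁ - L₀‖ < ρ → ‖L₂ - L₀‖ < ρ → IsRankProj r L₁ P₁ →
      IsRankProj r L₂ P₂ → frobNorm (P₂ - P₁) ≤ 2 * frobNorm (L₂ - L₁) := by
    intro L₁ P₁ L₂ P₂ hL₁ hL₂ hP₁ hP₂
    obtain ⟨t₁, b₁, f₁⟩ := hcrit L₁ P₁ hL₁ hP₁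
    obtain ⟨t₂, b₂, f₂⟩ := hcrit L₂ P₂ hL₂ hP₂
    refine t₁.frobNorm_sub_le t₂ (le_trans ?_ hρ2) (le_trans ?_ hρ2)
    · gcongr
    · gcongr
  have hex : ∀ L : V →L[ℂ] W, ‖L - L₀‖ < ρ → ∃ P, IsRankProj r L P := by
    intro L hL
    set C : Set (V →L[ℂ] W) :=
      {P | frobNorm (L - P) ≤ frobNorm (L - L₀)} ∩ {P | mapRank P ≤ r} with hC
    have hcont : Continuous fun P : V →L[ℂ] W => frobNorm (L - P) :=
      continuous_frobNorm.comp (continuous_const.sub continuous_id)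
    have hclosed : IsClosed C :=
      (isClosed_le hcont continuous_const).inter (mapRank_le_isClosed r)
    have hcompact : IsCompact C := by
      have : ProperSpace (V →L[ℂ] W) := FiniteDimensional.proper ℂ _
      refine Metric.isCompact_of_isClosed_isBounded hclosed
        (Metric.isBounded_closedBall.subset (s := C) (t := Metric.closedBall L₀ c) ?_)
      intro P hP
      rw [Metric.mem_closedBall, dist_eq_norm]
      exact (hnear L P hL hP.1).le
    obtain ⟨P, hPC, hmin⟩ := hcompact.exists_isMinOn ⟨L₀, le_refl (frobNorm (L - L₀)), hr.le⟩ hcont.continuousOn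
    -- The minimizer over rank at most `r` lies within `c` of `L₀`, so its rank is exactly `r`.
    refine ⟨P, le_antisymm hPC.2 (hrank P (hnear L P hL hPC.1)).1, fun Q hQ => ?_⟩
    rcases le_total (frobNorm (L - Q)) (frobNorm (L - L₀)) with h | h
    · exact hmin ⟨h, hQ.le⟩
    · exact hPC.1.trans h
  refine ⟨ρ, c⁻¹, 3 * (c⁻¹) ^ 2 * (2 * s), hρ0, by positivity, by positivity, fun L hL => ?_⟩
  have hP := rankProj_isRankProj (hex L hL)
  obtain ⟨t, b, -⟩ := hcrit L _ hL hP
  refine ⟨⟨_, hP, fun P' hP' => ?_⟩, b, t.pinv_apply_pinv, t.norm_sub_apply_pinv_le, fun L' hL' => ?_⟩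
  · have h := hlip L _ L P' hL hL hP hP'
    have h0 : frobNorm (L - L) = 0 := by
      rw [frobNorm_eq_norm_frobVec, sub_self, map_zero, norm_zero]
    rw [h0, mul_zero] at h
    exact sub_eq_zero.mp (norm_le_zero_iff.mp ((norm_le_frobNorm _).trans h))
  · have hP' := rankProj_isRankProj (hex L' hL')
    obtain ⟨-, b', -⟩ := hcrit L' _ hL' hP'
    refine (norm_pinv_sub_pinv_le _ _).trans ?_
    rw [mul_assoc]
    have hD : ‖rankProj r L' - rankProj r L‖ ≤ 2 * s * ‖L' - L‖ := by
      refine (norm_le_frobNorm _).trans ((hlip _ _ _ _ hL hL' hP hP').trans ?_)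
      rw [mul_assoc]
      gcongr
      exact frobNorm_le_norm _
    refine mul_le_mul ?_ hD (norm_nonneg _) (by positivity)
    have n1 := norm_nonneg (pinv (rankProj r L))
    have n2 := norm_nonneg (pinv (rankProj r L'))
    have p1 := mul_le_mul b' b n1 (by positivity)
    have p2 := mul_le_mul b b n1 (by positivity)
    have p3 := mul_le_mul b' b' n2 (by positivity)
    nlinarith

end RankProjectionLocal

/-! ### Local convergence of the rank-`r` Newton iteration. -/

section NewtonConvergence

/-- An iteration whose steps are at least halved near `c` stays near `c` and converges. -/
theorem exists_tendsto_of_step_halving {V : Type*} [NormedAddCommGroup V] [CompleteSpace V]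
    {N : V → V} {c : V} {τ : ℝ}
    (hN : ∀ x, ‖x - c‖ < τ → ‖x - N x - c‖ < τ → ‖N (x - N x)‖ ≤ ‖N x‖ / 2)
    {x : ℕ → V} (hx : ∀ j, x (j + 1) = x j - N (x j)) (h0 : ‖x 0 - c‖ + 2 * ‖N (x 0)‖ < τ) :
    (∀ j, ‖x j - c‖ < τ) ∧ ∃ z, Tendsto x atTop (𝓝 z) ∧ (∀ j, ‖x j - z‖ ≤ 2 * ‖N (x j)‖) ∧
      ‖z - c‖ ≤ ‖x 0 - c‖ + 2 * ‖N (x 0)‖ ∧ Tendsto (fun j => N (x j)) atTop (𝓝 0) := by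
  -- Halving makes `‖x j - c‖ + 2 ‖N (x j)‖` nonincreasing: a step moves by `‖N (x j)‖`, and the
  -- second term drops by at least as much.
  have hinv : ∀ j, ‖x j - c‖ + 2 * ‖N (x j)‖ ≤ ‖x 0 - c‖ + 2 * ‖N (x 0)‖ ∧
      ‖N (x (j + 1))‖ ≤ ‖N (x j)‖ / 2 := by
    have hstep : ∀ j, ‖x j - c‖ + 2 * ‖N (x j)‖ ≤ ‖x 0 - c‖ + 2 * ‖N (x 0)‖ →
        ‖N (x (j + 1))‖ ≤ ‖N (x j)‖ / 2 := by
      intro j hj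
      have hn := norm_nonneg (N (x j))
      have h1 : ‖x j - N (x j) - c‖ ≤ ‖x j - c‖ + ‖N (x j)‖ := by
        rw [sub_right_comm]; exact norm_sub_le _ _
      rw [hx]
      exact hN _ (by linarith) (by linarith)
    intro j
    induction j with
    | zero => exact ⟨le_refl _, hstep 0 (le_refl _)⟩
    | succ j ih =>
      have h1 : ‖x (j + 1) - c‖ ≤ ‖x j - c‖ + ‖N (x j)‖ := by
        rw [hx, sub_right_comm]; exact norm_sub_le _ _
      have h2 : ‖x (j + 1) - c‖ + 2 * ‖N (x (j + 1))‖ ≤ ‖x 0 - c‖ + 2 * ‖N (x 0)‖ := by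
        linarith [ih.1, ih.2]
      exact ⟨h2, hstep _ h2⟩
  have hgeom : ∀ j, ‖N (x j)‖ ≤ ‖N (x 0)‖ * (1 / 2) ^ j := by
    intro j
    induction j with
    | zero => simp
    | succ j ih =>
      rw [pow_succ]
      linarith [(hinv j).2]
  have hcauchy : CauchySeq x := by
    refine cauchySeq_of_le_geometric (1 / 2) ‖N (x 0)‖ (by norm_num) fun j => ?_
    rw [hx, dist_eq_norm, sub_sub_cancel]
    exact hgeom j
  obtain ⟨z, hz⟩ := cauchySeq_tendsto_of_complete hcauchy
  have htail : ∀ j, ‖x j - z‖ ≤ 2 * ‖N (x j)‖ := by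
    intro j
    have hi : ∀ i, ‖x j - x (i + j)‖ + 2 * ‖N (x (i + j))‖ ≤ 2 * ‖N (x j)‖ := by
      intro i
      induction i with
      | zero => simp
      | succ i ih =>
        have h1 : ‖x j - x (i + 1 + j)‖ ≤ ‖x j - x (i + j)‖ + ‖N (x (i + j))‖ := by
          rw [show i + 1 + j = i + j + 1 by ring, hx, sub_sub_eq_add_sub, add_sub_right_comm]
          exact norm_add_le _ _
        have h2 := (hinv (i + j)).2
        rw [show i + j + 1 = i + 1 + j by ring] at h2
        linarith
    refine le_of_tendsto (tendsto_const_nhds.sub ((tendsto_add_atTop_iff_nat j).mpr hz)).norm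
      (Eventually.of_forall fun i => ?_)
    have := hi i
    have hn := norm_nonneg (N (x (i + j)))
    linarith
  refine ⟨fun j => ?_, z, hz, htail, ?_, ?_⟩
  · have hn := norm_nonneg (N (x j))
    linarith [(hinv j).1]
  · refine le_of_tendsto (hz.sub_const c).norm (Eventually.of_forall fun j => ?_)
    have hn := norm_nonneg (N (x j))
    linarith [(hinv j).1]
  · rw [tendsto_zero_iff_norm_tendsto_zero]
    refine squeeze_zero (fun _ => norm_nonneg _) hgeom ?_
    have := (tendsto_pow_atTop_nhds_zero_of_lt_one (r := (1 / 2 : ℝ)) (by norm_num)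
      (by norm_num)).const_mul ‖N (x 0)‖
    simpa using this

variable {V W : Type*} [NormedAddCommGroup V] [InnerProductSpace ℂ V] [FiniteDimensional ℂ V]
  [NormedAddCommGroup W] [InnerProductSpace ℂ W] [FiniteDimensional ℂ W]

/-- The rank-`r` projections of the maps within `ρ` of `L₀` exist, are unique, and have
Moore-Penrose inverses that are bounded by `M` and `Λ`-Lipschitz. -/
structure RankProjLipschitz (r : ℕ) (L₀ : V →L[ℂ] W) (ρ M Λ : ℝ) : Prop where
  pos : 0 < ρ
  bound_nonneg : 0 ≤ M
  lip_nonneg : 0 ≤ Λ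
  existsUnique : ∀ L : V →L[ℂ] W, ‖L - L₀‖ < ρ → ∃! P, IsRankProj r L P
  bound : ∀ L : V →L[ℂ] W, ‖L - L₀‖ < ρ → ‖pinv (rankProj r L)‖ ≤ M
  outer_inverse : ∀ L : V →L[ℂ] W, ‖L - L₀‖ < ρ → ∀ w,
    pinv (rankProj r L) (L (pinv (rankProj r L) w)) = pinv (rankProj r L) w
  residual_le : ∀ L : V →L[ℂ] W, ‖L - L₀‖ < ρ → ∀ w, ‖w - L (pinv (rankProj r L) w)‖ ≤ ‖w‖
  lipschitz : ∀ L L' : V →L[ℂ] W, ‖L - L₀‖ < ρ → ‖L' - L₀‖ < ρ →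
    ‖pinv (rankProj r L') - pinv (rankProj r L)‖ ≤ Λ * ‖L' - L‖

theorem exists_rankProjLipschitz (L₀ : V →L[ℂ] W) {r : ℕ} (hr : mapRank L₀ = r) :
    ∃ ρ M Λ : ℝ, RankProjLipschitz r L₀ ρ M Λ := by
  obtain ⟨ρ, M, Λ, h0, hM, hΛ, h⟩ := exists_rankProj_lipschitz L₀ hr
  exact ⟨ρ, M, Λ, h0, hM, hΛ, fun L hL => (h L hL).1, fun L hL => (h L hL).2.1,
    fun L hL => (h L hL).2.2.1, fun L hL => (h L hL).2.2.2.1,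
    fun L L' hL hL' => (h L hL).2.2.2.2 L' hL'⟩

/-- Local convergence of the rank-`r` Newton iteration for a map with small values. -/
theorem newtonSeq_converges {r : ℕ} {L₀ : V →L[ℂ] W} {ρ M Λ : ℝ}
    (hR : RankProjLipschitz r L₀ ρ M Λ) {f : V → W} {c : V} {τ φ : ℝ}
    (hquad : ∀ x y, ‖f y - f x - fderiv ℂ f x (y - x)‖ ≤ ‖y - x‖ ^ 2)
    (hJ : ∀ x y, ‖fderiv ℂ f y - fderiv ℂ f x‖ ≤ 2 * ‖y - x‖)
    (hnear : ∀ x, ‖x - c‖ < τ → ‖fderiv ℂ f x - L₀‖ < ρ)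
    (hf : ∀ x, ‖x - c‖ < τ → ‖f x‖ ≤ φ) (hφ₁ : M ^ 2 * φ ≤ 1 / 4) (hφ₂ : 2 * Λ * φ ≤ 1 / 4)
    {x₀ : V} (h0 : ‖x₀ - c‖ + 2 * (M * ‖f x₀‖) < τ) :
    (∀ j, ‖newtonSeq r f x₀ j - c‖ < τ) ∧ ∃ z, Tendsto (newtonSeq r f x₀) atTop (𝓝 z) ∧
      (∀ j, ‖newtonSeq r f x₀ j - z‖ ≤ 2 * (M * ‖f (newtonSeq r f x₀ j)‖)) ∧
      ‖z - c‖ ≤ ‖x₀ - c‖ + 2 * (M * ‖f x₀‖) ∧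
      pinv (rankProj r (fderiv ℂ f z)) (f z) = 0 := by
  have hM := hR.bound_nonneg
  set N : V → V := fun x => pinv (rankProj r (fderiv ℂ f x)) (f x) with hNdef
  have hNle : ∀ x, ‖x - c‖ < τ → ‖N x‖ ≤ M * ‖f x‖ := fun x hx =>
    (ContinuousLinearMap.le_opNorm _ _).trans (by gcongr; exact hR.bound _ (hnear x hx))
  have hhalf : ∀ x, ‖x - c‖ < τ → ‖x - N x - c‖ < τ → ‖N (x - N x)‖ ≤ ‖N x‖ / 2 := by
    intro x hx hy
    set y := x - N x with hy'
    set Rx := pinv (rankProj r (fderiv ℂ f x)) with hRx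
    set Ry := pinv (rankProj r (fderiv ℂ f y)) with hRy
    have hyx : y - x = -N x := by rw [hy']; abel
    set e := f y - f x - fderiv ℂ f x (y - x) with he
    set g := f x - fderiv ℂ f x (N x) with hg
    -- Here `e` is the Taylor remainder and `g` the part of `f x` not removed by the step. The
    -- inverse `Rx` kills `g`, so at `y` it contributes only through `Ry - Rx`, of the order of the
    -- step times `φ`. The bounds `hφ₁` and `hφ₂` allot a quarter of the step to each of `e` and
    -- `g`.
    have hfy : f y = e + g := by
      rw [he, hg, hyx, map_neg]; abel
    have hRxg : Rx g = 0 := by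
      have := hR.outer_inverse _ (hnear x hx) (f x)
      rw [hg, map_sub, sub_eq_zero]
      exact this.symm
    have hNy : N y = Ry e + (Ry - Rx) g := by
      rw [sub_apply, hRxg, sub_zero, ← map_add, ← hfy]
    have h1 : ‖e‖ ≤ ‖N x‖ ^ 2 := by
      have := hquad x y
      rwa [hyx, norm_neg, ← hyx] at this
    have h2 : ‖Ry - Rx‖ ≤ Λ * (2 * ‖N x‖) := by
      refine (hR.lipschitz _ _ (hnear x hx) (hnear y hy)).trans ?_
      have := hJ x y
      rw [hyx, norm_neg] at this
      exact mul_le_mul_of_nonneg_left this hR.lip_nonneg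
    have h3 : ‖g‖ ≤ φ := (hR.residual_le _ (hnear x hx) (f x)).trans (hf x hx)
    have h4 : ‖N x‖ ≤ M * φ := (hNle x hx).trans (by gcongr; exact hf x hx)
    have h5 : ‖Ry e‖ ≤ M * ‖N x‖ ^ 2 :=
      (Ry.le_opNorm _).trans (mul_le_mul (hR.bound _ (hnear y hy)) h1 (norm_nonneg _) hM)
    have hΛ := hR.lip_nonneg
    have h6 : ‖(Ry - Rx) g‖ ≤ Λ * (2 * ‖N x‖) * φ :=
      ((Ry - Rx).le_opNorm _).trans (mul_le_mul h2 h3 (norm_nonneg _) (by positivity))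
    have h7 : M * ‖N x‖ ^ 2 ≤ M ^ 2 * φ * ‖N x‖ := by
      have := mul_le_mul_of_nonneg_left h4 (mul_nonneg hM (norm_nonneg (N x)))
      nlinarith
    rw [hNy]
    have hn := norm_nonneg (N x)
    calc _ ≤ ‖Ry e‖ + ‖(Ry - Rx) g‖ := norm_add_le _ _
      _ ≤ M ^ 2 * φ * ‖N x‖ + 2 * Λ * φ * ‖N x‖ := by linarith
      _ ≤ 1 / 4 * ‖N x‖ + 1 / 4 * ‖N x‖ := by gcongr
      _ = _ := by ring
  have hτ : ‖x₀ - c‖ < τ := by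
    have : 0 ≤ M * ‖f x₀‖ := by positivity
    linarith
  have hx0N := hNle x₀ hτ
  obtain ⟨hin, z, hz, htail, hzc, hN0⟩ := exists_tendsto_of_step_halving hhalf
    (x := newtonSeq r f x₀) (fun j => rfl) (by change ‖x₀ - c‖ + 2 * ‖N x₀‖ < τ; linarith)
  have hzc' : ‖z - c‖ ≤ ‖x₀ - c‖ + 2 * (M * ‖f x₀‖) := hzc.trans (by
    change ‖x₀ - c‖ + 2 * ‖N x₀‖ ≤ _; linarith)
  refine ⟨hin, z, hz, fun j => (htail j).trans ?_, hzc', ?_⟩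
  · exact mul_le_mul_of_nonneg_left (hNle _ (hin j)) zero_le_two
  · have hzτ : ‖z - c‖ < τ := hzc'.trans_lt h0
    have hJcont : Tendsto (fun j => fderiv ℂ f (newtonSeq r f x₀ j)) atTop
        (𝓝 (fderiv ℂ f z)) := by
      rw [tendsto_iff_norm_sub_tendsto_zero]
      refine squeeze_zero (fun _ => norm_nonneg _) (fun j => hJ z _) ?_
      have := (tendsto_iff_norm_sub_tendsto_zero.mp hz).const_mul 2
      simpa using this
    have hRcont : Tendsto (fun j => pinv (rankProj r (fderiv ℂ f (newtonSeq r f x₀ j)))) atTop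
        (𝓝 (pinv (rankProj r (fderiv ℂ f z)))) := by
      rw [tendsto_iff_norm_sub_tendsto_zero]
      refine squeeze_zero (fun _ => norm_nonneg _)
        (fun j => hR.lipschitz _ _ (hnear z hzτ) (hnear _ (hin j))) ?_
      have := (tendsto_iff_norm_sub_tendsto_zero.mp hJcont).const_mul Λ
      simpa using this
    have hfcont : Tendsto (fun j => f (newtonSeq r f x₀ j)) atTop (𝓝 (f z)) := by
      rw [tendsto_iff_norm_sub_tendsto_zero]
      have hz' := tendsto_iff_norm_sub_tendsto_zero.mp hz
      refine squeeze_zero (fun _ => norm_nonneg _) (g := fun j =>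
        ‖newtonSeq r f x₀ j - z‖ ^ 2 + ‖fderiv ℂ f z‖ * ‖newtonSeq r f x₀ j - z‖) (fun j => ?_) ?_
      · have h1 := hquad z (newtonSeq r f x₀ j)
        have h2 := (fderiv ℂ f z).le_opNorm (newtonSeq r f x₀ j - z)
        have h3 := norm_sub_norm_le (f (newtonSeq r f x₀ j) - f z)
          (fderiv ℂ f z (newtonSeq r f x₀ j - z))
        linarith
      · simpa using (hz'.pow 2).add (hz'.const_mul ‖fderiv ℂ f z‖)
    have hlim : Tendsto (fun j => N (newtonSeq r f x₀ j)) atTop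
        (𝓝 (pinv (rankProj r (fderiv ℂ f z)) (f z))) := by
      have hc : Continuous fun p : (W →L[ℂ] V) × W => p.1 p.2 := isBoundedBilinearMap_apply.continuous
      exact (hc.tendsto (pinv (rankProj r (fderiv ℂ f z)), f z)).comp (hRcont.prodMk_nhds hfcont)
    exact tendsto_nhds_unique hlim hN0

end NewtonConvergence

/-! ### The Sylvester operator for a nilpotent cyclic endomorphism. -/

section Sylvester

variable {E F : Type*} [AddCommGroup E] [Module ℂ E] [AddCommGroup F] [Module ℂ F]

/-- The map `X ↦ N X - X s`. -/
def sylvester (N : Module.End ℂ F) (s : Module.End ℂ E) : (E →ₗ[ℂ] F) →ₗ[ℂ] (E →ₗ[ℂ] F) where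
  toFun X := N ∘ₗ X - X ∘ₗ s
  map_add' X Y := by ext; simp; abel
  map_smul' a X := by ext; simp [smul_sub]

theorem sylvester_apply (N : Module.End ℂ F) (s : Module.End ℂ E) (X : E →ₗ[ℂ] F) (u : E) :
    sylvester N s X u = N (X u) - X (s u) := rfl

theorem apply_pow_of_mem_ker_sylvester {N : Module.End ℂ F} {s : Module.End ℂ E} {X : E →ₗ[ℂ] F}
    (hX : sylvester N s X = 0) (e : E) (j : ℕ) : X ((s ^ j) e) = (N ^ j) (X e) := by
  induction j with
  | zero => simp
  | succ j ih =>
    have h := congrArg (fun T : E →ₗ[ℂ] F => T ((s ^ j) e)) hX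
    simp only [sylvester_apply, LinearMap.zero_apply, sub_eq_zero] at h
    rw [pow_succ', Module.End.mul_apply, ← h, ih, pow_succ', Module.End.mul_apply]

variable {N : Module.End ℂ F} {s : Module.End ℂ E} {k : ℕ} {e : E}

theorem exists_mem_ker_sylvester (b : Module.Basis (Fin k) ℂ E) (hb : ∀ j, b j = (s ^ (j : ℕ)) e)
    (hk : 0 < k) (hs : s ^ k = 0) {v : F} (hv : (N ^ k) v = 0) :
    ∃ X : E →ₗ[ℂ] F, sylvester N s X = 0 ∧ X e = v := by
  set X : E →ₗ[ℂ] F := b.constr ℂ fun j : Fin k => (N ^ (j : ℕ)) v with hX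
  have hXj : ∀ j, j < k → X ((s ^ j) e) = (N ^ j) v := fun j hj => by
    have := b.constr_basis ℂ (fun j : Fin k => (N ^ (j : ℕ)) v) ⟨j, hj⟩
    rwa [hb] at this
  refine ⟨X, b.ext fun j => ?_, by simpa using hXj 0 hk⟩
  rw [sylvester_apply, hb, hXj _ j.2, ← Module.End.mul_apply, ← Module.End.mul_apply, ← pow_succ',
    ← pow_succ', LinearMap.zero_apply]
  rcases Nat.lt_or_ge (j + 1) k with h | h
  · rw [hXj _ h, sub_self]
  · have : (j : ℕ) + 1 = k := le_antisymm j.2 h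
    rw [this, hs, hv]; simp

/-- A solution is fixed by its value at the cyclic vector `e`, and `s ^ k = 0` requires only that `N
^ k` kill this value. -/
theorem finrank_ker_sylvester [FiniteDimensional ℂ F] (b : Module.Basis (Fin k) ℂ E)
    (hb : ∀ j, b j = (s ^ (j : ℕ)) e) (hk : 0 < k) (hs : s ^ k = 0) :
    Module.finrank ℂ (LinearMap.ker (sylvester N s)) =
      Module.finrank ℂ (LinearMap.ker (N ^ k)) := by
  let ev : LinearMap.ker (sylvester N s) →ₗ[ℂ] LinearMap.ker (N ^ k) :=
    LinearMap.codRestrict _ (LinearMap.applyₗ e ∘ₗ (LinearMap.ker (sylvester N s)).subtype)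
      fun X => by
        have h := apply_pow_of_mem_ker_sylvester X.2 e k
        rw [hs] at h
        rw [LinearMap.mem_ker]
        simpa using h.symm
  refine (LinearEquiv.ofBijective ev ⟨?_, ?_⟩).finrank_eq
  · rw [injective_iff_map_eq_zero]
    rintro ⟨X, hX⟩ h
    have hXe : X e = 0 := congrArg Subtype.val h
    refine Subtype.ext (b.ext fun j => ?_)
    change X (b j) = 0
    rw [hb, apply_pow_of_mem_ker_sylvester hX, hXe, map_zero]
  · rintro ⟨v, hv⟩
    obtain ⟨X, hX, hXe⟩ := exists_mem_ker_sylvester b hb hk hs hv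
    exact ⟨⟨X, hX⟩, Subtype.ext hXe⟩

/-- With `v = X e`, the equation forces `Y (s ^ j e) = N ^ j (Y e) - j N ^ (j - 1) v` by recursion.
The only obstruction is at `j = k`, where the left side is zero: `N ^ k (Y e) = k N ^ (k - 1) v`.
Since `k` is invertible in `ℂ`, this asks whether `N ^ (k - 1) v` is in the range of `N ^ k`. -/
theorem mem_range_sylvester_iff (b : Module.Basis (Fin k) ℂ E) (hb : ∀ j, b j = (s ^ (j : ℕ)) e)
    (hk : 0 < k) (hs : s ^ k = 0) {X : E →ₗ[ℂ] F} (hX : sylvester N s X = 0) :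
    (∃ Y, sylvester N s Y = X) ↔ ∃ w, (N ^ k) w = X ((s ^ (k - 1)) e) := by
  have hXj := apply_pow_of_mem_ker_sylvester hX e
  set v := X e
  obtain ⟨l, rfl⟩ : ∃ l, k = l + 1 := ⟨k - 1, by omega⟩
  have hl : ((l : ℂ) + 1) ≠ 0 := by exact_mod_cast Nat.succ_ne_zero l
  rw [Nat.add_sub_cancel, hXj]
  constructor
  · rintro ⟨Y, hY⟩
    have hYj : ∀ j : ℕ, Y ((s ^ (j + 1)) e) = (N ^ (j + 1)) (Y e) - ((j : ℂ) + 1) • (N ^ j) v := by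
      have hstep : ∀ j : ℕ, Y ((s ^ (j + 1)) e) = N (Y ((s ^ j) e)) - (N ^ j) v := by
        intro j
        rw [← hXj, ← hY, sylvester_apply, sub_sub_cancel, pow_succ', Module.End.mul_apply]
      intro j
      induction j with
      | zero => rw [hstep]; simp
      | succ j ih =>
        rw [hstep, ih, map_sub, map_smul, ← Module.End.mul_apply, ← Module.End.mul_apply,
          ← pow_succ', ← pow_succ']
        push_cast
        module
    have h := hYj l
    rw [hs, LinearMap.zero_apply, map_zero, eq_comm, sub_eq_zero] at h
    refine ⟨((l : ℂ) + 1)⁻¹ • Y e, ?_⟩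
    rw [map_smul, h, inv_smul_smul₀ hl]
  · rintro ⟨w, hw⟩
    obtain ⟨y, hy⟩ : ∃ y : F, y = ((l : ℂ) + 1) • w := ⟨_, rfl⟩
    -- At `j = 0` the truncated exponent `j - 1` is harmless because its coefficient is zero.
    set Y : E →ₗ[ℂ] F :=
      b.constr ℂ fun j : Fin (l + 1) => (N ^ (j : ℕ)) y - (j : ℂ) • (N ^ ((j : ℕ) - 1)) v with hY
    have hYj : ∀ j, j < l + 1 → Y ((s ^ j) e) = (N ^ j) y - (j : ℂ) • (N ^ (j - 1)) v :=
      fun j hj => by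
        have := b.constr_basis ℂ
          (fun j : Fin (l + 1) => (N ^ (j : ℕ)) y - (j : ℂ) • (N ^ ((j : ℕ) - 1)) v) ⟨j, hj⟩
        rwa [hb] at this
    have hNY : ∀ j, j < l + 1 → N (Y ((s ^ j) e)) = (N ^ (j + 1)) y - (j : ℂ) • (N ^ j) v := by
      intro j hj
      rw [hYj j hj, map_sub, map_smul, ← Module.End.mul_apply, ← pow_succ']
      cases j with
      | zero => simp
      | succ j => rw [Nat.add_sub_cancel, ← Module.End.mul_apply, ← pow_succ']
    refine ⟨Y, b.ext fun j => ?_⟩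
    rw [sylvester_apply, hb, hNY _ j.2, hXj, ← Module.End.mul_apply, ← pow_succ']
    rcases Nat.lt_or_ge (j + 1) (l + 1) with h | h
    · rw [hYj _ h]
      push_cast
      module
    · have : (j : ℕ) = l := le_antisymm (Nat.lt_succ_iff.mp j.2) (Nat.succ_le_succ_iff.mp h)
      rw [this, hs, LinearMap.zero_apply, map_zero, hy, map_smul, hw]
      module

/-- For `j < k`, the map `N ^ j` carries `ker (N ^ (j + 1))` onto `ker N` with kernel `ker (N ^ j)`,
so each power adds the same dimension. -/
theorem finrank_ker_pow [FiniteDimensional ℂ F] {k : ℕ}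
    (h : ∀ x, N x = 0 → ∃ w, (N ^ (k - 1)) w = x) :
    Module.finrank ℂ (LinearMap.ker (N ^ k)) = Module.finrank ℂ (LinearMap.ker N) * k := by
  suffices ∀ j, j ≤ k → Module.finrank ℂ (LinearMap.ker (N ^ j)) =
      Module.finrank ℂ (LinearMap.ker N) * j from this k le_rfl
  intro j
  induction j with
  | zero => intro _; simp [Module.End.one_eq_id, LinearMap.ker_id]
  | succ j ih =>
    intro hj
    let g : LinearMap.ker (N ^ (j + 1)) →ₗ[ℂ] F := (N ^ j) ∘ₗ (LinearMap.ker (N ^ (j + 1))).subtype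
    have hrange : LinearMap.range g = LinearMap.ker N := by
      apply le_antisymm
      · rintro _ ⟨⟨x, hx⟩, rfl⟩
        rw [LinearMap.mem_ker, pow_succ', Module.End.mul_apply] at hx
        exact hx
      · intro x hx
        obtain ⟨w, hw⟩ := h x hx
        have h1 : (N ^ j) ((N ^ (k - 1 - j)) w) = x := by
          rw [← Module.End.mul_apply, ← pow_add, Nat.add_sub_cancel' (by omega), hw]
        refine ⟨⟨(N ^ (k - 1 - j)) w, ?_⟩, h1⟩
        rw [LinearMap.mem_ker, pow_succ', Module.End.mul_apply, h1]
        exact hx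
    have hker : Module.finrank ℂ (LinearMap.ker g) = Module.finrank ℂ (LinearMap.ker (N ^ j)) := by
      have hle : LinearMap.ker (N ^ j) ≤ LinearMap.ker (N ^ (j + 1)) := fun x hx => by
        rw [LinearMap.mem_ker] at hx ⊢
        rw [pow_succ', Module.End.mul_apply, hx, map_zero]
      have : LinearMap.ker g = (LinearMap.ker (N ^ j)).comap (LinearMap.ker (N ^ (j + 1))).subtype :=
        LinearMap.ker_comp _ _
      rw [this]
      exact (Submodule.comapSubtypeEquivOfLe hle).finrank_eq
    have := LinearMap.finrank_range_add_finrank_ker g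
    rw [hrange, hker, ih (by omega)] at this
    rw [← this]
    ring

/-- The orbit of a vector under a nilpotent endomorphism is linearly independent up to the last
nonzero vector. -/
theorem linearIndependent_nilpotent_orbit (hk : 0 < k) (hs : s ^ k = 0)
    (he : (s ^ (k - 1)) e ≠ 0) : LinearIndependent ℂ fun j : Fin k => (s ^ (j : ℕ)) e := by
  rw [Fintype.linearIndependent_iff]
  intro a ha
  have hz : ∀ p, k ≤ p → (s ^ p) e = 0 := fun p hp => by
    obtain ⟨q, rfl⟩ := Nat.exists_eq_add_of_le hp
    rw [add_comm, pow_add, hs, mul_zero, LinearMap.zero_apply]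
  rintro ⟨i, hi⟩
  induction i using Nat.strong_induction_on with
  | _ i ih =>
    -- If the coefficients before `i` vanish, this power of `s` kills every term after `i` and
    -- leaves the last nonzero orbit vector.
    have h := congrArg (s ^ (k - 1 - i)) ha
    rw [map_sum, map_zero, Finset.sum_eq_single (⟨i, hi⟩ : Fin k)] at h
    · rw [map_smul, ← Module.End.mul_apply, ← pow_add, Nat.sub_add_cancel (by omega)] at h
      exact (smul_eq_zero.mp h).resolve_right he
    · rintro ⟨j, hj⟩ - hne
      rcases lt_or_ge j i with hlt | hge
      · rw [ih j hlt hj, zero_smul, map_zero]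
      · have : j ≠ i := fun h => hne (Fin.ext h)
        rw [map_smul, ← Module.End.mul_apply, ← pow_add, hz _ (by dsimp only; omega), smul_zero]
    · intro h; exact absurd (Finset.mem_univ _) h

end Sylvester

/-! ### The cyclic basis attached to `S`. -/

section NilpotentParameter

variable {k : ℕ} {S : Matrix (Fin k) (Fin k) ℂ}

/-- On the `p`-th superdiagonal only one path of single steps contributes, so the entry is a product
of superdiagonal entries of `S`. -/
theorem IsNilpotentParameter.pow_apply (hS : IsNilpotentParameter S) (p : ℕ) (i l : Fin k) :
    ((l : ℕ) < i + p → (S ^ p) i l = 0) ∧ ((l : ℕ) = i + p → (S ^ p) i l ≠ 0) := by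
  induction p generalizing i l with
  | zero =>
    refine ⟨fun h => ?_, fun h => ?_⟩
    · rw [pow_zero, Matrix.one_apply_ne]
      rintro rfl; omega
    · rw [pow_zero, Fin.ext (h.symm : (i : ℕ) = l), Matrix.one_apply_eq]; exact one_ne_zero
  | succ p ih =>
    rw [pow_succ', Matrix.mul_apply]
    refine ⟨fun h => Finset.sum_eq_zero fun x _ => ?_, fun h => ?_⟩
    · rcases le_or_gt x i with hx | hx
      · rw [hS.1 i x hx, zero_mul]
      · rw [(ih x l).1 (by have : (i : ℕ) < x := hx; omega), mul_zero]
    · rw [Finset.sum_eq_single (⟨i + 1, by omega⟩ : Fin k)]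
      · exact mul_ne_zero (hS.2 _ _ rfl) ((ih _ l).2 (by dsimp only; omega))
      · intro x _ hne
        rcases le_or_gt x i with hx | hx
        · rw [hS.1 i x hx, zero_mul]
        · have h1 : (i : ℕ) < x := hx
          have h2 : (x : ℕ) ≠ i + 1 := fun h => hne (Fin.ext h)
          rw [(ih x l).1 (by omega), mul_zero]
      · intro h; exact absurd (Finset.mem_univ _) h

theorem IsNilpotentParameter.pow_eq_zero (hS : IsNilpotentParameter S) : S ^ k = 0 := by
  ext i l
  exact (hS.pow_apply k i l).1 (by omega)

theorem IsNilpotentParameter.exists_pow_mulVec (hS : IsNilpotentParameter S) (hk : 0 < k) :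
    ∃ c : ℂ, c ≠ 0 ∧ (S ^ (k - 1)).mulVec (Pi.single ⟨k - 1, by omega⟩ 1) =
      c • (Pi.single ⟨0, hk⟩ 1 : Fin k → ℂ) := by
  refine ⟨(S ^ (k - 1)) ⟨0, hk⟩ ⟨k - 1, by omega⟩, (hS.pow_apply _ _ _).2 (by simp), ?_⟩
  ext i
  rw [Matrix.mulVec_single_one, Matrix.col_apply]
  by_cases hi : i = ⟨0, hk⟩
  · simp [hi]
  · rw [(hS.pow_apply _ _ _).1 (by
      have : (i : ℕ) ≠ 0 := fun h => hi (Fin.ext h)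
      dsimp only; omega)]
    simp [hi]

/-- The orbit of the last standard basis vector under `S` is a basis. -/
theorem IsNilpotentParameter.exists_basis (hS : IsNilpotentParameter S) (hk : 0 < k) :
    ∃ (e : Fin k → ℂ) (c : ℂ) (b : Module.Basis (Fin k) ℂ (Fin k → ℂ)),
      (∀ j, b j = (Matrix.toLin' S ^ (j : ℕ)) e) ∧ Matrix.toLin' S ^ k = 0 ∧ c ≠ 0 ∧
        (Matrix.toLin' S ^ (k - 1)) e = c • Pi.single ⟨0, hk⟩ 1 := by
  obtain ⟨c, hc, h⟩ := hS.exists_pow_mulVec hk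
  have hs : Matrix.toLin' S ^ k = 0 := by
    rw [← Matrix.toLin'_pow, hS.pow_eq_zero, map_zero]
  have he : (Matrix.toLin' S ^ (k - 1)) (Pi.single ⟨k - 1, by omega⟩ 1) =
      c • (Pi.single ⟨0, hk⟩ 1 : Fin k → ℂ) := by
    rw [← Matrix.toLin'_pow, Matrix.toLin'_apply, h]
  have hli := linearIndependent_nilpotent_orbit hk hs (by
    rw [he]
    exact smul_ne_zero hc (by simp))
  have : Nonempty (Fin k) := ⟨⟨0, hk⟩⟩
  exact ⟨_, c, basisOfLinearIndependentOfCardEqFinrank hli (by simp), fun j => by simp, hs, hc, he⟩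

end NilpotentParameter

/-! ### Kernels and ranges of powers, read off the Jordan form. -/

section JordanForm

theorem jordanBlock_sub_smul (μ lam : ℂ) (s : ℕ) :
    jordanBlock μ s - lam • (1 : Matrix (Fin s) (Fin s) ℂ) = jordanBlock (μ - lam) s := by
  ext i j
  by_cases h : i = j
  · simp [jordanBlock, h]
  · simp [jordanBlock, h, Matrix.one_apply_ne]

theorem jordanBlock_zero_pow_apply (s p : ℕ) (i j : Fin s) :
    (jordanBlock 0 s ^ p) i j = if (i : ℕ) + p = j then 1 else 0 := by
  induction p generalizing i with
  | zero => simp [Matrix.one_apply, Fin.ext_iff]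
  | succ p ih =>
    have hJ : ∀ x, jordanBlock 0 s i x = if (i : ℕ) + 1 = x then 1 else 0 := by
      intro x
      by_cases h : i = x
      · simp [jordanBlock, h]
      · simp [jordanBlock, h]
    rw [pow_succ', Matrix.mul_apply]
    simp only [ih, hJ, ite_mul, one_mul, zero_mul]
    by_cases hi : (i : ℕ) + 1 < s
    · rw [Finset.sum_eq_single (⟨i + 1, hi⟩ : Fin s)]
      · simp [add_assoc, add_comm 1 p]
      · intro x _ hne
        rw [if_neg]
        exact fun h => hne (Fin.ext h.symm)
      · intro h; exact absurd (Finset.mem_univ _) h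
    · rw [Finset.sum_eq_zero, if_neg]
      · have := j.2; omega
      · intro x _
        rw [if_neg]
        have := x.2; omega

theorem jordanBlock_mulVec_injective {μ : ℂ} (hμ : μ ≠ 0) {s : ℕ} {u : Fin s → ℂ}
    (hu : (jordanBlock μ s).mulVec u = 0) : u = 0 := by
  by_contra hne
  refine absurd (Matrix.exists_mulVec_eq_zero_iff.mp ⟨u, hne, hu⟩) ?_
  rw [Matrix.det_of_isUpperTriangular]
  · simp [jordanBlock, hμ]
  · intro i j hij
    have h1 : (j : ℕ) < i := hij
    have h2 : i ≠ j := fun h => by rw [h] at h1; exact lt_irrefl _ h1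
    simp only [jordanBlock, Matrix.of_apply]
    rw [if_neg h2, if_neg (by omega)]

/-- A nilpotent block of size at least `k` has its kernel spanned by the first basis vector, which
is the image of the `k`-th one under the power `k - 1`. A block with `μ ≠ 0` is injective. -/
theorem jordanBlock_ker_le_range {μ : ℂ} {s k : ℕ} (hk : μ = 0 → k ≤ s) {u : Fin s → ℂ}
    (hu : (jordanBlock μ s).mulVec u = 0) : ∃ w, (jordanBlock μ s ^ (k - 1)).mulVec w = u := by
  by_cases hμ : μ = 0
  · subst hμ
    rcases Nat.eq_zero_or_pos s with rfl | hs
    · exact ⟨u, Subsingleton.elim _ _⟩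
    have hk' : k - 1 < s := by have := hk rfl; omega
    refine ⟨Pi.single ⟨k - 1, hk'⟩ (u ⟨0, hs⟩), ?_⟩
    ext i
    rw [Matrix.mulVec_single, Pi.smul_apply, Matrix.col_apply, jordanBlock_zero_pow_apply]
    by_cases hi : (i : ℕ) = 0
    · rw [if_pos (by dsimp only; omega)]
      have hi' : i = ⟨0, hs⟩ := Fin.ext hi
      simp [hi']
    · rw [if_neg (by dsimp only; omega)]
      have h := congrFun hu ⟨i - 1, by omega⟩
      rw [← pow_one (jordanBlock 0 s), Matrix.mulVec, dotProduct,
        Finset.sum_eq_single i] at h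
      · rw [jordanBlock_zero_pow_apply, if_pos (by dsimp only; omega)] at h
        simpa using h.symm
      · intro x _ hne
        rw [jordanBlock_zero_pow_apply, if_neg, zero_mul]
        intro h'
        exact hne (Fin.ext (by dsimp only at h'; omega))
      · intro h; exact absurd (Finset.mem_univ _) h
  · exact ⟨0, by rw [jordanBlock_mulVec_injective hμ hu, Matrix.mulVec_zero]⟩

theorem blockDiagonal'_mulVec_apply {q : ℕ} {s : Fin q → ℕ}
    (J : ∀ i, Matrix (Fin (s i)) (Fin (s i)) ℂ) (u : (Σ i, Fin (s i)) → ℂ) (i : Fin q)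
    (a : Fin (s i)) :
    (Matrix.blockDiagonal' J).mulVec u ⟨i, a⟩ = (J i).mulVec (fun x => u ⟨i, x⟩) a := by
  rw [Matrix.mulVec, dotProduct, Fintype.sum_sigma, Finset.sum_eq_single i]
  · simp [Matrix.mulVec, dotProduct]
  · intro x _ hne
    refine Finset.sum_eq_zero fun y _ => ?_
    rw [Matrix.blockDiagonal'_apply_ne _ _ _ hne.symm, zero_mul]
  · intro h; exact absurd (Finset.mem_univ _) h

/-- With smallest Jordan block of size `k`, the kernel of `A - lam` lies in the range of its
`k - 1`-st power, and some vector is mapped by this power to the kernel but not to the range of the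
`k`-th power. -/
theorem HasMultiplicitySupport.pow_facts {n m k : ℕ} {A : Matrix (Fin n) (Fin n) ℂ} {lam : ℂ}
    (h : HasMultiplicitySupport A lam m k) :
    0 < k ∧ (∀ x, (A - lam • (1 : Matrix (Fin n) (Fin n) ℂ)).mulVec x = 0 →
      ∃ w, ((A - lam • (1 : Matrix (Fin n) (Fin n) ℂ)) ^ (k - 1)).mulVec w = x) ∧
    ∃ v, ((A - lam • (1 : Matrix (Fin n) (Fin n) ℂ)) ^ k).mulVec v = 0 ∧
      ∀ w, ((A - lam • (1 : Matrix (Fin n) (Fin n) ℂ)) ^ k).mulVec w ≠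
        ((A - lam • (1 : Matrix (Fin n) (Fin n) ℂ)) ^ (k - 1)).mulVec v := by
  obtain ⟨-, q, μ, s, ⟨hpos, P, Q, hPQ, hQP, hA⟩, ⟨i₀, hi₀, hsk⟩, hmin⟩ := h
  set D := Matrix.blockDiagonal' fun i => jordanBlock (μ i - lam) (s i) with hD
  have hN : A - lam • (1 : Matrix (Fin n) (Fin n) ℂ) = P * D * Q := by
    have h1 : D = Matrix.blockDiagonal' (fun i => jordanBlock (μ i) (s i)) -
        lam • (1 : Matrix (Σ i, Fin (s i)) (Σ i, Fin (s i)) ℂ) := by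
      rw [hD, ← Matrix.blockDiagonal'_one, ← Matrix.blockDiagonal'_smul,
        ← Matrix.blockDiagonal'_sub]
      congr 1
      funext i
      exact (jordanBlock_sub_smul _ _ _).symm
    rw [h1, Matrix.mul_sub, Matrix.sub_mul, ← hA, Matrix.mul_smul, Matrix.mul_one, Matrix.smul_mul,
      hPQ]
  have hNp : ∀ p : ℕ, (A - lam • (1 : Matrix (Fin n) (Fin n) ℂ)) ^ p = P * D ^ p * Q := by
    intro p
    induction p with
    | zero => rw [pow_zero, pow_zero, Matrix.mul_one, hPQ]
    | succ p ih =>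
      rw [pow_succ, ih, hN, pow_succ]
      calc P * D ^ p * Q * (P * D * Q) = P * D ^ p * (Q * P) * D * Q := by
            simp only [Matrix.mul_assoc]
        _ = _ := by rw [hQP, Matrix.mul_one]; simp only [Matrix.mul_assoc]
  have hDp : ∀ (p : ℕ) (u : (Σ i, Fin (s i)) → ℂ) (i : Fin q) (a : Fin (s i)),
      (D ^ p).mulVec u ⟨i, a⟩ = (jordanBlock (μ i - lam) (s i) ^ p).mulVec (fun x => u ⟨i, x⟩) a := by
    intro p u i a
    rw [hD, ← Matrix.blockDiagonal'_pow, blockDiagonal'_mulVec_apply]; rfl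
  have hPinj : ∀ u w, P.mulVec u = P.mulVec w → u = w := fun u w h => by
    have := congrArg Q.mulVec h
    simpa [Matrix.mulVec_mulVec, hQP] using this
  refine ⟨hsk ▸ hpos i₀, fun x hx => ?_, ?_⟩
  · have hDx : D.mulVec (Q.mulVec x) = 0 := by
      refine hPinj _ _ ?_
      rw [Matrix.mulVec_zero, ← hx, hN, Matrix.mulVec_mulVec, Matrix.mulVec_mulVec,
        Matrix.mul_assoc]
    have hblock : ∀ i, ∃ w, (jordanBlock (μ i - lam) (s i) ^ (k - 1)).mulVec w =
        fun a => Q.mulVec x ⟨i, a⟩ := by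
      intro i
      refine jordanBlock_ker_le_range (fun h0 => hmin ⟨i, sub_eq_zero.mp h0, rfl⟩) ?_
      ext a
      have := congrFun hDx ⟨i, a⟩
      rwa [← pow_one D, hDp, pow_one] at this
    choose w hw using hblock
    refine ⟨P.mulVec fun p => w p.1 p.2, ?_⟩
    have hDw : (D ^ (k - 1)).mulVec (fun p => w p.1 p.2) = Q.mulVec x := by
      ext ⟨i, a⟩
      rw [hDp, hw]
    rw [hNp, Matrix.mulVec_mulVec, Matrix.mul_assoc, hQP, Matrix.mul_one, ← Matrix.mulVec_mulVec,
      hDw, Matrix.mulVec_mulVec, hPQ, Matrix.one_mulVec]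
  · subst hsk
    have hk := hpos i₀
    have hlast : s i₀ - 1 < s i₀ := by omega
    have hzero : μ i₀ - lam = 0 := sub_eq_zero.mpr hi₀
    have hJk : jordanBlock 0 (s i₀) ^ s i₀ = 0 := by
      ext a b
      rw [jordanBlock_zero_pow_apply, if_neg (by have := b.2; omega), Matrix.zero_apply]
    have hcomp : ∀ (p : ℕ) (w : Fin n → ℂ),
        ((A - lam • (1 : Matrix (Fin n) (Fin n) ℂ)) ^ p).mulVec w =
          P.mulVec ((D ^ p).mulVec (Q.mulVec w)) := by
      intro p w
      rw [hNp, Matrix.mulVec_mulVec, Matrix.mulVec_mulVec, Matrix.mul_assoc]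
    have hQPv : ∀ u, Q.mulVec (P.mulVec u) = u := fun u => by
      rw [Matrix.mulVec_mulVec, hQP, Matrix.one_mulVec]
    -- The last vector of a block of size exactly `k`: the power `k - 1` sends it to the first
    -- vector of that block, whereas the `k`-th power vanishes on the whole block.
    refine ⟨P.mulVec (Pi.single ⟨i₀, ⟨s i₀ - 1, hlast⟩⟩ 1), ?_, fun w hw => ?_⟩
    · rw [hcomp, hQPv]
      have : (D ^ s i₀).mulVec (Pi.single ⟨i₀, ⟨s i₀ - 1, hlast⟩⟩ 1) = 0 := by
        ext ⟨i, a⟩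
        rw [hDp]
        by_cases hi : i = i₀
        · subst hi
          rw [hzero, hJk, Matrix.zero_mulVec]; rfl
        · have : (fun x => (Pi.single ⟨i₀, ⟨s i₀ - 1, hlast⟩⟩ 1 : (Σ i, Fin (s i)) → ℂ) ⟨i, x⟩) =
              0 := by
            ext x
            rw [Pi.single_eq_of_ne]; · rfl
            intro h; exact hi (congrArg Sigma.fst h)
          rw [this, Matrix.mulVec_zero]; rfl
      rw [this, Matrix.mulVec_zero]
    · rw [hcomp, hcomp, hQPv] at hw
      have h1 := congrFun (hPinj _ _ hw) ⟨i₀, ⟨0, hk⟩⟩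
      rw [hDp, hDp, hzero, hJk, Matrix.zero_mulVec] at h1
      have h2 : (fun x => (Pi.single ⟨i₀, ⟨s i₀ - 1, hlast⟩⟩ 1 : (Σ i, Fin (s i)) → ℂ) ⟨i₀, x⟩) =
          Pi.single ⟨s i₀ - 1, hlast⟩ 1 := by
        ext x
        by_cases hx : x = ⟨s i₀ - 1, hlast⟩
        · subst hx; simp
        · rw [Pi.single_eq_of_ne hx, Pi.single_eq_of_ne]
          intro h; exact hx (eq_of_heq (Sigma.mk.inj h).2)
      rw [h2, Matrix.mulVec_single_one, Matrix.col_apply, jordanBlock_zero_pow_apply] at h1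
      simp at h1

end JordanForm

/-! ### Solutions of the matrix equation and the rank of its Jacobian. -/

section EigenvalueEquation

variable {n k : ℕ}

theorem toMat_ofMat (M : Matrix (Fin n) (Fin k) ℂ) : toMat (ofMat M) = M := rfl

theorem ofMat_toMat (X : FMat n k) : ofMat (toMat X) = X := rfl

/-- Matrices with the Frobenius norm as linear maps. -/
noncomputable def matLin : FMat n k ≃ₗ[ℂ] ((Fin k → ℂ) →ₗ[ℂ] (Fin n → ℂ)) :=
  LinearEquiv.trans
    { toFun := toMat, invFun := ofMat, left_inv := ofMat_toMat, right_inv := toMat_ofMat,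
      map_add' := fun _ _ => rfl, map_smul' := fun _ _ => rfl }
    Matrix.toLin'

theorem matLin_apply (X : FMat n k) : matLin X = Matrix.toLin' (toMat X) := rfl

theorem matLin_single (X : FMat n k) (j : Fin k) :
    matLin X (Pi.single j 1) = fun i => toMat X i j := by
  rw [matLin_apply, Matrix.toLin'_apply, Matrix.mulVec_single_one]
  rfl

/-- The map `X ↦ A X - lam X - X S`, linear for fixed `lam`. -/
noncomputable def eigSylv (S : Matrix (Fin k) (Fin k) ℂ) (A : Matrix (Fin n) (Fin n) ℂ) (lam : ℂ) :
    FMat n k →ₗ[ℂ] FMat n k where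
  toFun X := ofMat (A * toMat X - lam • toMat X - toMat X * S)
  map_add' X Y := by
    have h : toMat (X + Y) = toMat X + toMat Y := rfl
    rw [h, Matrix.mul_add, Matrix.add_mul, smul_add]
    have e : A * toMat X + A * toMat Y - (lam • toMat X + lam • toMat Y) -
        (toMat X * S + toMat Y * S) = (A * toMat X - lam • toMat X - toMat X * S) +
          (A * toMat Y - lam • toMat Y - toMat Y * S) := by abel
    rw [e]
    rfl
  map_smul' a X := by
    have h : toMat (a • X) = a • toMat X := rfl
    rw [h, Matrix.mul_smul, Matrix.smul_mul, smul_comm lam a, ← smul_sub, ← smul_sub]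
    rfl

theorem eigSylv_apply (S : Matrix (Fin k) (Fin k) ℂ) (A : Matrix (Fin n) (Fin n) ℂ) (lam : ℂ)
    (X : FMat n k) : eigSylv S A lam X = ofMat (A * toMat X - lam • toMat X - toMat X * S) := rfl

theorem matLin_eigSylv (S : Matrix (Fin k) (Fin k) ℂ) (A : Matrix (Fin n) (Fin n) ℂ) (lam : ℂ)
    (X : FMat n k) : matLin (eigSylv S A lam X) =
      sylvester (Matrix.toLin' (A - lam • (1 : Matrix (Fin n) (Fin n) ℂ))) (Matrix.toLin' S)
        (matLin X) := by
  have e : ∀ (N : Module.End ℂ (Fin n → ℂ)) (s : Module.End ℂ (Fin k → ℂ)) Z,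
    sylvester N s Z = N ∘ₗ Z - Z ∘ₗ s := fun _ _ _ => rfl
  rw [e, matLin_apply, matLin_apply, eigSylv_apply, toMat_ofMat, ← Matrix.toLin'_mul,
    ← Matrix.toLin'_mul, ← map_sub, Matrix.sub_mul, Matrix.smul_mul, Matrix.one_mul]

theorem mem_eigSolutions_iff {S : Matrix (Fin k) (Fin k) ℂ} {A : Matrix (Fin n) (Fin n) ℂ}
    {lam : ℂ} {X : FMat n k} : X ∈ eigSolutions S A lam ↔ eigSylv S A lam X = 0 := Iff.rfl

theorem eigSylv_eq_zero_iff {S : Matrix (Fin k) (Fin k) ℂ} {A : Matrix (Fin n) (Fin n) ℂ}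
    {lam : ℂ} {X : FMat n k} : eigSylv S A lam X = 0 ↔
      sylvester (Matrix.toLin' (A - lam • (1 : Matrix (Fin n) (Fin n) ℂ))) (Matrix.toLin' S)
        (matLin X) = 0 := by
  rw [← matLin_eigSylv, LinearEquiv.map_eq_zero_iff]

theorem exists_eigSylv_eq_iff {S : Matrix (Fin k) (Fin k) ℂ} {A : Matrix (Fin n) (Fin n) ℂ}
    {lam : ℂ} {X : FMat n k} : (∃ Y, eigSylv S A lam Y = X) ↔
      ∃ Y, sylvester (Matrix.toLin' (A - lam • (1 : Matrix (Fin n) (Fin n) ℂ))) (Matrix.toLin' S)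
        Y = matLin X := by
  constructor
  · rintro ⟨Y, rfl⟩
    exact ⟨matLin Y, (matLin_eigSylv _ _ _ _).symm⟩
  · rintro ⟨Y, hY⟩
    refine ⟨matLin.symm Y, matLin.injective ?_⟩
    rw [matLin_eigSylv, LinearEquiv.apply_symm_apply, hY]

variable {m : ℕ} {A : Matrix (Fin n) (Fin n) ℂ} {lam : ℂ} {S : Matrix (Fin k) (Fin k) ℂ}

/-- The generic solutions are those outside the range of `X ↦ A X - lam X - X S`. -/
theorem mem_genericSolutions_iff (hA : HasMultiplicitySupport A lam m k)
    (hS : IsNilpotentParameter S) {X : FMat n k} : X ∈ genericSolutions S A lam ↔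
      eigSylv S A lam X = 0 ∧ ¬ ∃ Y, eigSylv S A lam Y = X := by
  obtain ⟨hk, -, -⟩ := hA.pow_facts
  refine and_congr_right fun hX => ?_
  obtain ⟨e, c, b, hb, hs, hc, he⟩ := hS.exists_basis hk
  -- Since `s ^ (k - 1) e` is `c` times the first standard vector, the range criterion becomes one
  -- on the first column of `X`.
  rw [exists_eigSylv_eq_iff, mem_range_sylvester_iff b hb hk hs
    (eigSylv_eq_zero_iff.mp (mem_eigSolutions_iff.mp hX)), he,
    map_smul, matLin_single, ← Matrix.toLin'_pow]
  constructor
  · rintro h ⟨w, hw⟩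
    refine h ⟨0, hk⟩ rfl ⟨c⁻¹ • w, ?_⟩
    rw [← Matrix.toLin'_apply, map_smul, hw, inv_smul_smul₀ hc]
  · rintro h j hj ⟨w, hw⟩
    obtain rfl : j = ⟨0, hk⟩ := Fin.ext hj
    refine h ⟨c • w, ?_⟩
    rw [map_smul, Matrix.toLin'_apply, hw]

theorem finrank_ker_eigSylv (hA : HasMultiplicitySupport A lam m k)
    (hS : IsNilpotentParameter S) :
    Module.finrank ℂ (LinearMap.ker (eigSylv S A lam)) = m * k := by
  obtain ⟨hk, hker, -⟩ := hA.pow_facts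
  obtain ⟨e, c, b, hb, hs, -, -⟩ := hS.exists_basis hk
  set N := Matrix.toLin' (A - lam • (1 : Matrix (Fin n) (Fin n) ℂ)) with hN
  have h1 : LinearMap.ker (eigSylv S A lam) =
      (LinearMap.ker (sylvester N (Matrix.toLin' S))).comap
        (matLin : FMat n k ≃ₗ[ℂ] _).toLinearMap := by
    ext X
    exact eigSylv_eq_zero_iff
  have h2 : Module.finrank ℂ (LinearMap.ker (eigSylv S A lam)) =
      Module.finrank ℂ (LinearMap.ker (sylvester N (Matrix.toLin' S))) := by
    rw [h1]
    exact (LinearEquiv.ofSubmodule' (matLin : FMat n k ≃ₗ[ℂ] _) _).finrank_eq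
  rw [h2, finrank_ker_sylvester b hb hk hs, finrank_ker_pow]
  · rw [← hA.1]
    have hE : Module.End.eigenspace (Matrix.toLin' A) lam = LinearMap.ker N := by
      ext x
      rw [LinearMap.mem_ker, Module.End.mem_eigenspace_iff, hN, map_sub, map_smul,
        Matrix.toLin'_one, LinearMap.sub_apply, sub_eq_zero]
      rfl
    rw [hE]
  · intro x hx
    obtain ⟨w, hw⟩ := hker x hx
    exact ⟨w, by rw [hN, ← Matrix.toLin'_pow]; exact hw⟩

theorem exists_mem_genericSolutions (hA : HasMultiplicitySupport A lam m k)
    (hS : IsNilpotentParameter S) : ∃ X, X ∈ genericSolutions S A lam := by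
  obtain ⟨hk, -, v, hv, hv'⟩ := hA.pow_facts
  obtain ⟨e, c, b, hb, hs, -, -⟩ := hS.exists_basis hk
  set N := Matrix.toLin' (A - lam • (1 : Matrix (Fin n) (Fin n) ℂ)) with hN
  obtain ⟨X, hX, hXe⟩ := exists_mem_ker_sylvester (N := N) (v := v) b hb hk hs (by
    rw [hN, ← Matrix.toLin'_pow]; exact hv)
  have hXX : sylvester N (Matrix.toLin' S) (matLin (matLin.symm X : FMat n k)) = 0 := by
    rw [LinearEquiv.apply_symm_apply, hX]
  refine ⟨matLin.symm X, (mem_genericSolutions_iff hA hS).mpr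
    ⟨eigSylv_eq_zero_iff.mpr hXX, ?_⟩⟩
  rw [exists_eigSylv_eq_iff, mem_range_sylvester_iff b hb hk hs hXX]
  rintro ⟨w, hw⟩
  rw [LinearEquiv.apply_symm_apply, apply_pow_of_mem_ker_sylvester hX, hXe, hN,
    ← Matrix.toLin'_pow, ← Matrix.toLin'_pow] at hw
  exact hv' w hw

theorem HasMultiplicitySupport.le (hA : HasMultiplicitySupport A lam m k) : m ≤ n := by
  rw [← hA.1]
  exact (Submodule.finrank_le _).trans_eq (by simp)

/-- A non-generic solution lies in the range of the linear map `eigSylv S A lam`; adding any nonzero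
multiple of a generic solution leaves that subspace. -/
theorem eigSolutions_subset_closure (hA : HasMultiplicitySupport A lam m k)
    (hS : IsNilpotentParameter S) :
    eigSolutions S A lam ⊆ closure (genericSolutions S A lam) := by
  intro X hX
  by_cases hg : X ∈ genericSolutions S A lam
  · exact subset_closure hg
  rw [mem_eigSolutions_iff] at hX
  rw [mem_genericSolutions_iff hA hS, not_and, not_not] at hg
  obtain ⟨Y, hY⟩ := hg hX
  obtain ⟨X₀, hX₀⟩ := exists_mem_genericSolutions hA hS
  rw [mem_genericSolutions_iff hA hS] at hX₀
  have ht : Tendsto (fun t : ℂ => X + t • X₀) (𝓝[≠] 0) (𝓝 X) := by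
    have : Continuous fun t : ℂ => X + t • X₀ := by fun_prop
    simpa using (this.tendsto 0).mono_left nhdsWithin_le_nhds
  refine mem_closure_of_tendsto ht (eventually_mem_nhdsWithin.mono fun t ht => ?_)
  refine (mem_genericSolutions_iff hA hS).mpr ⟨?_, ?_⟩
  · rw [map_add, map_smul, hX, hX₀.1, smul_zero, add_zero]
  · rintro ⟨Z, hZ⟩
    refine hX₀.2 ⟨t⁻¹ • (Z - Y), ?_⟩
    rw [map_smul, map_sub, hZ, hY, add_sub_cancel_left, inv_smul_smul₀ ht]

/-- The derivative of `eigMap S G` at `x`. -/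
noncomputable def eigJac (S : Matrix (Fin k) (Fin k) ℂ) (G : Matrix (Fin n) (Fin n) ℂ)
    (x : EigSpace n k) : EigSpace n k →L[ℂ] FMat n k :=
  LinearMap.toContinuousLinearMap
    { toFun := fun h => eigSylv S G x.fst h.snd - h.fst • x.snd
      map_add' := fun h h' => by
        rw [WithLp.add_snd, WithLp.add_fst, map_add, add_smul]; abel
      map_smul' := fun a h => by
        rw [WithLp.smul_snd, WithLp.smul_fst, map_smul, RingHom.id_apply, smul_sub, smul_assoc] }

theorem eigJac_apply (G : Matrix (Fin n) (Fin n) ℂ) (x h : EigSpace n k) :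
    eigJac S G x h = eigSylv S G x.fst h.snd - h.fst • x.snd := rfl

theorem eigMap_eq (G : Matrix (Fin n) (Fin n) ℂ) (x : EigSpace n k) :
    eigMap S G x = eigSylv S G x.fst x.snd := rfl

theorem eigSylv_sub (G : Matrix (Fin n) (Fin n) ℂ) (a b : ℂ) (X : FMat n k) :
    eigSylv S G a X - eigSylv S G b X = -((a - b) • X) := by
  ext p
  change (G * toMat X - a • toMat X - toMat X * S) p.1 p.2 -
    (G * toMat X - b • toMat X - toMat X * S) p.1 p.2 = -((a - b) * X p)
  simp only [Matrix.sub_apply, Matrix.smul_apply, toMat, Matrix.of_apply, smul_eq_mul]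
  ring

theorem eigSylv_sub_eigSylv (G G' : Matrix (Fin n) (Fin n) ℂ) (a : ℂ) (X : FMat n k) :
    eigSylv S G a X - eigSylv S G' a X = ofMat ((G - G') * toMat X) := by
  ext p
  change (G * toMat X - a • toMat X - toMat X * S) p.1 p.2 -
    (G' * toMat X - a • toMat X - toMat X * S) p.1 p.2 = ((G - G') * toMat X) p.1 p.2
  rw [Matrix.sub_mul]
  simp only [Matrix.sub_apply]
  ring

/-- The only nonlinear term is the product of `lam` and `X`, so the Taylor remainder is exactly one
bilinear term. -/
theorem eigMap_sub_sub (G : Matrix (Fin n) (Fin n) ℂ) (x y : EigSpace n k) :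
    eigMap S G y - eigMap S G x - eigJac S G x (y - x) =
      -((y.fst - x.fst) • (y.snd - x.snd)) := by
  have h := eigSylv_sub (S := S) G y.fst x.fst y.snd
  rw [eigMap_eq, eigMap_eq, eigJac_apply, WithLp.sub_snd, WithLp.sub_fst, map_sub, smul_sub,
    neg_sub, ← sub_eq_zero] at *
  rw [← h]
  module

theorem norm_eigSpace_fst_le (h : EigSpace n k) : ‖h.fst‖ ≤ ‖h‖ := by
  have := WithLp.prod_norm_sq_eq_of_L2 h
  exact le_of_sq_le_sq (by nlinarith [sq_nonneg ‖h.snd‖]) (norm_nonneg _)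

theorem norm_eigSpace_snd_le (h : EigSpace n k) : ‖h.snd‖ ≤ ‖h‖ := by
  have := WithLp.prod_norm_sq_eq_of_L2 h
  exact le_of_sq_le_sq (by nlinarith [sq_nonneg ‖h.fst‖]) (norm_nonneg _)

theorem norm_eigMap_sub_sub_le (G : Matrix (Fin n) (Fin n) ℂ) (x y : EigSpace n k) :
    ‖eigMap S G y - eigMap S G x - eigJac S G x (y - x)‖ ≤ ‖y - x‖ ^ 2 := by
  rw [eigMap_sub_sub, norm_neg, norm_smul, sq]
  exact mul_le_mul (norm_eigSpace_fst_le (y - x)) (norm_eigSpace_snd_le (y - x)) (norm_nonneg _) (norm_nonneg _)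

theorem hasFDerivAt_eigMap (G : Matrix (Fin n) (Fin n) ℂ) (x : EigSpace n k) :
    HasFDerivAt (eigMap S G) (eigJac S G x) x := by
  refine HasFDerivAt.of_isLittleO (Asymptotics.IsBigO.trans_isLittleO
    (g := fun y => ‖y - x‖ ^ 2) (Asymptotics.IsBigO.of_bound 1 (Eventually.of_forall fun y => ?_))
    ?_)
  · rw [one_mul, Real.norm_of_nonneg (by positivity)]
    exact norm_eigMap_sub_sub_le G x y
  · exact Asymptotics.isLittleO_pow_sub_sub x one_lt_two

theorem fderiv_eigMap (G : Matrix (Fin n) (Fin n) ℂ) (x : EigSpace n k) :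
    fderiv ℂ (eigMap S G) x = eigJac S G x :=
  (hasFDerivAt_eigMap G x).fderiv

theorem norm_ofMat_sq {p q : ℕ} (M : Matrix (Fin p) (Fin q) ℂ) :
    ‖ofMat M‖ ^ 2 = ∑ i, ∑ j, ‖M i j‖ ^ 2 := by
  rw [EuclideanSpace.norm_sq_eq, Fintype.sum_prod_type]
  rfl

theorem norm_ofMat_mul_le (M : Matrix (Fin n) (Fin n) ℂ) (X : FMat n k) :
    ‖ofMat (M * toMat X)‖ ≤ ‖ofMat M‖ * ‖X‖ := by
  refine le_of_sq_le_sq ?_ (by positivity)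
  have hX : ‖X‖ ^ 2 = ∑ j, ∑ l, ‖toMat X l j‖ ^ 2 := by
    rw [Finset.sum_comm, ← norm_ofMat_sq, ofMat_toMat]
  rw [mul_pow, norm_ofMat_sq, norm_ofMat_sq, hX, Finset.sum_mul_sum]
  refine Finset.sum_le_sum fun i _ => Finset.sum_le_sum fun j _ => ?_
  refine le_trans ?_ (Finset.sum_mul_sq_le_sq_mul_sq _ _ _)
  gcongr
  rw [Matrix.mul_apply]
  refine (norm_sum_le _ _).trans_eq ?_
  simp

open scoped Matrix.Norms.L2Operator in
theorem norm_ofMat_mul_le_specNorm (M : Matrix (Fin n) (Fin n) ℂ) (X : FMat n k) :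
    ‖ofMat (M * toMat X)‖ ≤ ‖ofMat M‖ * specNorm X := by
  have hspec : specNorm X = ‖(toMat X).conjTranspose‖ := by
    rw [Matrix.l2_opNorm_conjTranspose, Matrix.l2_opNorm_def]; rfl
  refine le_of_sq_le_sq ?_ (mul_nonneg (norm_nonneg _) (hspec ▸ norm_nonneg _))
  rw [mul_pow, norm_ofMat_sq, norm_ofMat_sq, Finset.sum_mul, hspec]
  refine Finset.sum_le_sum fun i _ => ?_
  -- Row by row: up to conjugation, row `i` of the product is the conjugate transpose of `X` applied
  -- to row `i` of `M`. This is where the spectral norm enters the final estimate.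
  have h := Matrix.l2_opNorm_mulVec (toMat X).conjTranspose (WithLp.toLp 2 (star (M i)))
  have h2 := pow_le_pow_left₀ (norm_nonneg _) h 2
  rw [mul_pow, EuclideanSpace.norm_sq_eq, EuclideanSpace.norm_sq_eq, mul_comm] at h2
  have e1 : ∀ j, ‖(M * toMat X) i j‖ =
      ‖((toMat X).conjTranspose.mulVec (star (M i))) j‖ := by
    intro j
    rw [← norm_star, Matrix.mulVec, dotProduct, Matrix.mul_apply, star_sum]
    congr 1
    refine Finset.sum_congr rfl fun l _ => ?_
    simp [Matrix.conjTranspose_apply, mul_comm]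
  simp only [e1]
  simpa using h2

theorem norm_eigJac_sub_le (G G' : Matrix (Fin n) (Fin n) ℂ) (x y : EigSpace n k) :
    ‖eigJac S G y - eigJac S G' x‖ ≤ ‖ofMat (G - G')‖ + 2 * ‖y - x‖ := by
  refine ContinuousLinearMap.opNorm_le_bound _ (by positivity) fun h => ?_
  have e : (eigJac S G y - eigJac S G' x) h =
      ofMat ((G - G') * toMat h.snd) - (y.fst - x.fst) • h.snd - h.fst • (y.snd - x.snd) := by
    rw [sub_apply, eigJac_apply, eigJac_apply, ← eigSylv_sub_eigSylv (S := S) G G' y.fst]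
    have := eigSylv_sub (S := S) G' y.fst x.fst h.snd
    rw [sub_eq_iff_eq_add] at this
    rw [this]
    module
  rw [e]
  have h1 : ‖ofMat ((G - G') * toMat h.snd)‖ ≤ ‖ofMat (G - G')‖ * ‖h‖ :=
    (norm_ofMat_mul_le _ _).trans (by gcongr; exact norm_eigSpace_snd_le h)
  have h2 : ‖(y.fst - x.fst) • h.snd‖ ≤ ‖y - x‖ * ‖h‖ := by
    rw [norm_smul]
    exact mul_le_mul (norm_eigSpace_fst_le (y - x)) (norm_eigSpace_snd_le h) (norm_nonneg _) (norm_nonneg _)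
  have h3 : ‖h.fst • (y.snd - x.snd)‖ ≤ ‖h‖ * ‖y - x‖ := by
    rw [norm_smul]
    exact mul_le_mul (norm_eigSpace_fst_le h) (norm_eigSpace_snd_le (y - x)) (norm_nonneg _) (norm_nonneg _)
  refine (norm_sub_le _ _).trans ?_
  have := norm_sub_le (ofMat ((G - G') * toMat h.snd)) ((y.fst - x.fst) • h.snd)
  linarith

theorem finrank_eigSpace : Module.finrank ℂ (EigSpace n k) = 1 + n * k := by
  rw [(WithLp.linearEquiv 2 ℂ (ℂ × FMat n k)).finrank_eq, Module.finrank_prod]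
  simp

theorem mem_ker_eigJac_iff {X : FMat n k} (hX : ¬ ∃ Y, eigSylv S A lam Y = X)
    {h : EigSpace n k} : eigJac S A (eigPt lam X) h = 0 ↔ h.fst = 0 ∧ eigSylv S A lam h.snd = 0 := by
  change eigSylv S A lam h.snd - h.fst • X = 0 ↔ _
  constructor
  · intro h0
    have hfst : h.fst = 0 := by
      by_contra hne
      refine hX ⟨(h.fst)⁻¹ • h.snd, ?_⟩
      rw [map_smul, sub_eq_zero.mp h0, inv_smul_smul₀ hne]
    refine ⟨hfst, ?_⟩
    rw [hfst, zero_smul, sub_zero] at h0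
    exact h0
  · rintro ⟨h1, h2⟩
    rw [h1, h2, zero_smul, sub_zero]

/-- The Jacobian at a solution has the expected rank exactly at the generic solutions. -/
theorem mapRank_eigJac_iff (hA : HasMultiplicitySupport A lam m k)
    (hS : IsNilpotentParameter S) {X : FMat n k} (hX : X ∈ eigSolutions S A lam) :
    mapRank (eigJac S A (eigPt lam X)) = 1 + (n - m) * k ↔ X ∈ genericSolutions S A lam := by
  have hX0 := mem_eigSolutions_iff.mp hX
  have hT := finrank_ker_eigSylv hA hS
  have hle : m * k ≤ n * k := Nat.mul_le_mul_right k hA.le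
  rw [mem_genericSolutions_iff hA hS, Nat.sub_mul]
  constructor
  · intro h
    refine ⟨hX0, ?_⟩
    rintro ⟨Y, hY⟩
    -- When `X = T Y`, the Jacobian adds nothing to the range of `T`, and its rank is at most `(n -
    -- m) k`, one short.
    have hr : mapRank (eigJac S A (eigPt lam X)) ≤
        Module.finrank ℂ (LinearMap.range (eigSylv S A lam)) := by
      refine Submodule.finrank_mono ?_
      rintro _ ⟨h, rfl⟩
      refine ⟨h.snd - h.fst • Y, ?_⟩
      rw [map_sub, map_smul, hY]
      rfl
    have hd := LinearMap.finrank_range_add_finrank_ker (eigSylv S A lam)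
    have hnk : Module.finrank ℂ (FMat n k) = n * k := by simp
    rw [hT, hnk] at hd
    omega
  · rintro ⟨-, hgen⟩
    have hd := LinearMap.finrank_range_add_finrank_ker
      (eigJac S A (eigPt lam X) : EigSpace n k →ₗ[ℂ] FMat n k)
    have hker : Module.finrank ℂ (LinearMap.ker
        (eigJac S A (eigPt lam X) : EigSpace n k →ₗ[ℂ] FMat n k)) = m * k := by
      rw [← hT]
      refine LinearEquiv.finrank_eq
        { toFun := fun h => ⟨h.1.snd, ((mem_ker_eigJac_iff hgen).mp h.2).2⟩
          map_add' := fun _ _ => rfl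
          map_smul' := fun _ _ => rfl
          invFun := fun Y => ⟨eigPt 0 Y.1, (mem_ker_eigJac_iff hgen).mpr ⟨rfl, Y.2⟩⟩
          left_inv := fun h => ?_
          right_inv := fun Y => rfl }
      refine Subtype.ext ?_
      have := ((mem_ker_eigJac_iff hgen).mp h.2).1
      change WithLp.toLp 2 ((0 : ℂ), h.1.snd) = h.1
      rw [← this]
      rfl
    rw [hker, finrank_eigSpace] at hd
    change mapRank _ + _ = _ at hd
    omega

end EigenvalueEquation

/-! ### Error estimates relative to the nearest exact solution. -/

section Convergence

variable {n k m : ℕ} {A : Matrix (Fin n) (Fin n) ℂ} {lam : ℂ} {S : Matrix (Fin k) (Fin k) ℂ}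

theorem eventually_mul_le (a : ℝ) {b : ℝ} (hb : 0 < b) : ∀ᶠ t in 𝓝[>] (0 : ℝ), a * t ≤ b := by
  have h : Tendsto (fun t : ℝ => a * t) (𝓝 0) (𝓝 (a * 0)) := (continuous_const_mul a).tendsto 0
  rw [mul_zero] at h
  exact (h.mono_left nhdsWithin_le_nhds).eventually_le_const hb

theorem eigPt_sub (a b : ℂ) (X Y : FMat n k) : eigPt a X - eigPt b Y = eigPt (a - b) (X - Y) := rfl

theorem norm_eigPt_sub_eigPt (a : ℂ) (X Y : FMat n k) : ‖eigPt a X - eigPt a Y‖ = ‖X - Y‖ := by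
  have h := WithLp.prod_norm_sq_eq_of_L2 (eigPt a X - eigPt a Y)
  rw [eigPt_sub] at h ⊢
  have e1 : WithLp.fst (eigPt (a - a) (X - Y)) = a - a := rfl
  have e2 : WithLp.snd (eigPt (a - a) (X - Y)) = X - Y := rfl
  rw [e1, e2, sub_self, norm_zero] at h
  have h' : ‖eigPt (a - a) (X - Y)‖ ^ 2 = ‖X - Y‖ ^ 2 := by
    rw [sub_self, h]; ring
  exact (sq_eq_sq₀ (norm_nonneg _) (norm_nonneg _)).mp h'

/-- Generic solutions are stable among the solutions. -/
theorem exists_ball_generic (hA : HasMultiplicitySupport A lam m k) (hS : IsNilpotentParameter S)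
    {X₀ : FMat n k} (hX₀ : X₀ ∈ genericSolutions S A lam) :
    ∃ ε : ℝ, 0 < ε ∧ ∀ X, eigSylv S A lam X = 0 → ‖X - X₀‖ < ε → X ∈ genericSolutions S A lam := by
  rw [mem_genericSolutions_iff hA hS] at hX₀
  have hclosed : IsClosed (LinearMap.range (eigSylv S A lam) : Set (FMat n k)) :=
    Submodule.closed_of_finiteDimensional _
  obtain ⟨ε, hε, h⟩ := Metric.isOpen_iff.mp hclosed.isOpen_compl X₀ (fun h => hX₀.2 h)
  refine ⟨ε, hε, fun X hX hd => (mem_genericSolutions_iff hA hS).mpr ⟨hX, fun hr => ?_⟩⟩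
  exact h (by rwa [Metric.mem_ball, dist_eq_norm]) hr

/-- The orthogonal projection of a point onto the exact solutions: the difference is orthogonal to
the kernel of the Jacobian, so it is recovered from its image by the Moore-Penrose inverse. -/
theorem exists_nearest_solution (hA : HasMultiplicitySupport A lam m k)
    (hS : IsNilpotentParameter S) {X₀ : FMat n k} (hX₀ : eigSylv S A lam X₀ = 0) {ε : ℝ}
    (hε : ∀ X, eigSylv S A lam X = 0 → ‖X - X₀‖ < ε → X ∈ genericSolutions S A lam)
    {z : EigSpace n k} (hz : ‖z - eigPt lam X₀‖ < ε) :
    ∃ X ∈ genericSolutions S A lam, ‖X - X₀‖ ≤ ‖z - eigPt lam X₀‖ ∧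
      (∀ Y, eigSylv S A lam Y = 0 → ‖z - eigPt lam X‖ ≤ ‖z - eigPt lam Y‖) ∧
      pinv (eigJac S A (eigPt lam X)) (eigJac S A (eigPt lam X) (z - eigPt lam X)) =
        z - eigPt lam X ∧
      mapRank (eigJac S A (eigPt lam X)) = 1 + (n - m) * k := by
  set K := LinearMap.ker (eigSylv S A lam)
  set X := K.starProjection z.snd with hX
  have hXK : X ∈ K := Submodule.starProjection_apply_mem _ _
  have hproj : ∀ Y ∈ K, X - Y = K.starProjection (z.snd - Y) := fun Y hY => by
    rw [map_sub, Submodule.starProjection_eq_self_iff.mpr hY]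
  have hdist : ‖X - X₀‖ ≤ ‖z - eigPt lam X₀‖ := by
    rw [hproj _ hX₀]
    exact (Submodule.norm_starProjection_apply_le _ _).trans
      (norm_eigSpace_snd_le (z - eigPt lam X₀))
  have hgen := hε X hXK (hdist.trans_lt hz)
  have hnr := ((mem_genericSolutions_iff hA hS).mp hgen).2
  refine ⟨X, hgen, hdist, fun Y hY => ?_, ?_, (mapRank_eigJac_iff hA hS hgen.1).mpr hgen⟩
  · have h1 := WithLp.prod_norm_sq_eq_of_L2 (z - eigPt lam X)
    have h2 := WithLp.prod_norm_sq_eq_of_L2 (z - eigPt lam Y)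
    have h3 : ‖z.snd - X‖ ≤ ‖z.snd - Y‖ := by
      have : z.snd - X = Kᗮ.starProjection (z.snd - Y) := by
        rw [Submodule.starProjection_orthogonal, sub_apply, ← hproj Y hY]
        simp
      rw [this]
      exact Submodule.norm_starProjection_apply_le _ _
    refine le_of_sq_le_sq ?_ (norm_nonneg _)
    rw [h1, h2]
    change ‖z.fst - lam‖ ^ 2 + ‖z.snd - X‖ ^ 2 ≤ ‖z.fst - lam‖ ^ 2 + ‖z.snd - Y‖ ^ 2
    gcongr
  · rw [pinv_apply]
    refine Submodule.starProjection_eq_self_iff.mpr ((Submodule.mem_orthogonal _ _).mpr ?_)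
    -- At a generic solution the kernel of the Jacobian is `0 × ker T`, so projecting only the
    -- matrix component already makes the difference orthogonal to it.
    intro h hh
    obtain ⟨h1, h2⟩ := (mem_ker_eigJac_iff hnr).mp hh
    rw [WithLp.prod_inner_apply]
    have h3 : inner ℂ h.snd (z.snd - X) = 0 :=
      Submodule.inner_right_of_mem_orthogonal (K := K) h2 (Submodule.sub_starProjection_mem_orthogonal _)
    change inner ℂ h.fst (z.fst - lam) + inner ℂ h.snd (z.snd - X) = 0
    rw [h3, h1, inner_zero_left, add_zero]

theorem eigMap_eigPt_eq_zero {X : FMat n k} (hX : eigSylv S A lam X = 0) :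
    eigMap S A (eigPt lam X) = 0 := hX

theorem norm_eigMap_le {X : FMat n k} (hX : eigSylv S A lam X = 0) {B : ℝ}
    (hB : ‖eigJac S A (eigPt lam X)‖ + 1 ≤ B) {y : EigSpace n k} (hy : ‖y - eigPt lam X‖ ≤ 1) :
    ‖eigMap S A y‖ ≤ B * ‖y - eigPt lam X‖ := by
  have h := norm_eigMap_sub_sub_le (S := S) A (eigPt lam X) y
  rw [eigMap_eigPt_eq_zero hX, sub_zero] at h
  have h1 := (eigJac S A (eigPt lam X)).le_opNorm (y - eigPt lam X)
  have h2 := norm_sub_norm_le (eigMap S A y) (eigJac S A (eigPt lam X) (y - eigPt lam X))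
  have hn := norm_nonneg (y - eigPt lam X)
  nlinarith

theorem eigMap_sub_eigMap (G G' : Matrix (Fin n) (Fin n) ℂ) (x : EigSpace n k) :
    eigMap S G x - eigMap S G' x = ofMat ((G - G') * toMat x.snd) :=
  eigSylv_sub_eigSylv G G' x.fst x.snd

theorem norm_ofMat_sub_comm (G G' : Matrix (Fin n) (Fin n) ℂ) :
    ‖ofMat (G - G')‖ = ‖ofMat (G' - G)‖ := by
  rw [← norm_neg]
  congr 1
  ext p
  change -(G p.1 p.2 - G' p.1 p.2) = G' p.1 p.2 - G p.1 p.2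
  ring

theorem quadratic_collect {Λ M B d e κ : ℝ} (hΛ : 0 ≤ Λ) (hM : 0 ≤ M) (hB : 0 ≤ B) (hd : 0 ≤ d)
    (he : 0 ≤ e)
    (h : e ≤ Λ * (d + 2 * e) * (B * (d + e)) + (κ * d + M * (d * e)) + M * e ^ 2) :
    e ≤ κ * d + (2 * Λ * B + M) * (d + e) ^ 2 := by
  have i1 : 0 ≤ Λ * B * (d * (d + e)) := by positivity
  have i2 : 0 ≤ M * (d ^ 2 + d * e) := by positivity
  nlinarith

/-- Write `(d + e) ^ 2 = d ^ 2 + (2 d + e) e`; the last term costs at most `e / 2`, and moving it to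
the left doubles the other constants. -/
theorem quadratic_absorb {G d e κ t : ℝ} (hG : 0 ≤ G) (he : 0 ≤ e) (hdt : d ≤ t)
    (het : e ≤ t) (ht : 3 * G * t ≤ 1 / 2) (h : e ≤ κ * d + G * (d + e) ^ 2) :
    e ≤ 2 * κ * d + 2 * G * d ^ 2 := by
  have j1 : G * (2 * d + e) * e ≤ 1 / 2 * e := by
    refine mul_le_mul_of_nonneg_right ?_ he
    have : G * (2 * d + e) ≤ G * (3 * t) := by gcongr; linarith
    linarith
  linarith

/-- Distance from a stationary point of the perturbed iteration to the exact solutions. -/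
theorem norm_sub_solution_le {r : ℕ} {L₀ : EigSpace n k →L[ℂ] FMat n k} {ρ M Λ B t : ℝ}
    (hR : RankProjLipschitz r L₀ ρ M Λ) {X : FMat n k} (hX : eigSylv S A lam X = 0)
    (hrank : mapRank (eigJac S A (eigPt lam X)) = r)
    (hXnear : ‖eigJac S A (eigPt lam X) - L₀‖ < ρ)
    (hB : ‖eigJac S A (eigPt lam X)‖ + 1 ≤ B) {A' : Matrix (Fin n) (Fin n) ℂ}
    {z : EigSpace n k} (hzB : ‖z.snd‖ ≤ B)
    (hperp : pinv (eigJac S A (eigPt lam X)) (eigJac S A (eigPt lam X) (z - eigPt lam X)) =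
      z - eigPt lam X)
    (hznear : ‖eigJac S A' z - L₀‖ < ρ)
    (hstat : pinv (rankProj r (eigJac S A' z)) (eigMap S A' z) = 0)
    (hd : ‖ofMat (A - A')‖ ≤ t) (he : ‖z - eigPt lam X‖ ≤ t) (ht : t ≤ 1)
    (hG : 3 * (2 * Λ * B + M) * t ≤ 1 / 2) :
    ‖z - eigPt lam X‖ ≤
      2 * ‖pinv (rankProj r (eigJac S A (eigPt lam X)))‖ * specNorm X * ‖ofMat (A - A')‖ +
        2 * (2 * Λ * B + M) * ‖ofMat (A - A')‖ ^ 2 := by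
  set J := eigJac S A (eigPt lam X) with hJ
  set R := pinv (rankProj r J) with hRdef
  set R' := pinv (rankProj r (eigJac S A' z)) with hR'def
  set w := z - eigPt lam X with hw
  set d := ‖ofMat (A - A')‖ with hddef
  have hRJ : R = pinv J := by rw [hRdef, rankProj_of_mapRank hrank]
  have hRM : ‖R‖ ≤ M := hR.bound J hXnear
  have hΛ := hR.lip_nonneg
  have hM := hR.bound_nonneg
  have hd0 : 0 ≤ d := norm_nonneg _
  have he0 : 0 ≤ ‖w‖ := norm_nonneg _
  have hB0 : 0 ≤ B := (norm_nonneg _).trans hzB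
  set q := eigMap S A z - J w with hq
  have hqle : ‖q‖ ≤ ‖w‖ ^ 2 := by
    have h := norm_eigMap_sub_sub_le (S := S) A (eigPt lam X) z
    rwa [eigMap_eigPt_eq_zero hX, sub_zero] at h
  set p := ofMat ((A - A') * toMat z.snd) with hp
  have hfz : eigMap S A z = eigMap S A' z + p := by
    rw [hp, ← eigMap_sub_eigMap (S := S)]; abel
  -- Stationarity removes `R'` applied to the perturbed value. The first term is of second order
  -- because both factors are of first order, `R p` carries the linear error, and `R q` the Taylor
  -- remainder.
  have hsplit : w = (R - R') (eigMap S A' z) + R p - R q := by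
    rw [sub_apply, hstat, sub_zero, ← map_add, ← hfz, ← map_sub, hq, sub_sub_cancel, hRJ, hperp]
  have h1 : ‖R - R'‖ ≤ Λ * (d + 2 * ‖w‖) := by
    refine (hR.lipschitz _ _ hznear hXnear).trans ?_
    have := norm_eigJac_sub_le (S := S) A A' z (eigPt lam X)
    rw [norm_sub_rev] at this
    gcongr
    rwa [hw, norm_sub_rev z, ← norm_sub_rev (eigJac S A' z)]
  have h2 : ‖eigMap S A' z‖ ≤ B * (d + ‖w‖) := by
    have e1 : ‖eigMap S A z‖ ≤ B * ‖w‖ := norm_eigMap_le hX hB (he.trans ht)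
    have e2 : ‖p‖ ≤ d * B := (norm_ofMat_mul_le _ _).trans (by gcongr)
    have e3 : eigMap S A' z = eigMap S A z - p := by rw [hfz]; abel
    rw [e3]
    refine (norm_sub_le _ _).trans ?_
    linarith
  have h3 : ‖p‖ ≤ d * specNorm X + d * ‖w‖ := by
    have e : p = ofMat ((A - A') * toMat X) + ofMat ((A - A') * toMat w.snd) := by
      have e1 : toMat z.snd = toMat X + toMat w.snd := by
        change toMat z.snd = toMat (X + (z.snd - X))
        rw [add_sub_cancel]
      rw [hp, e1, Matrix.mul_add]
      rfl
    rw [e]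
    refine (norm_add_le _ _).trans (add_le_add (norm_ofMat_mul_le_specNorm _ _) ?_)
    exact (norm_ofMat_mul_le _ _).trans (by gcongr; exact norm_eigSpace_snd_le w)
  have t1 : ‖(R - R') (eigMap S A' z)‖ ≤ Λ * (d + 2 * ‖w‖) * (B * (d + ‖w‖)) :=
    ((R - R').le_opNorm _).trans (mul_le_mul h1 h2 (norm_nonneg _) (by positivity))
  have t2 : ‖R p‖ ≤ ‖R‖ * specNorm X * d + M * (d * ‖w‖) := by
    refine (R.le_opNorm _).trans ((mul_le_mul_of_nonneg_left h3 (norm_nonneg _)).trans ?_)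
    have : ‖R‖ * (d * ‖w‖) ≤ M * (d * ‖w‖) := by gcongr
    linarith
  have t3 : ‖R q‖ ≤ M * ‖w‖ ^ 2 := (R.le_opNorm _).trans (by gcongr)
  have hmain : ‖w‖ ≤ ‖R‖ * specNorm X * d + (2 * Λ * B + M) * (d + ‖w‖) ^ 2 := by
    have : ‖w‖ ≤ ‖(R - R') (eigMap S A' z)‖ + ‖R p‖ + ‖R q‖ := by
      conv_lhs => rw [hsplit]
      exact (norm_sub_le _ _).trans (by gcongr; exact norm_add_le _ _)
    exact quadratic_collect hΛ hM hB0 hd0 he0 (this.trans (add_le_add (add_le_add t1 t2) t3))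
  rw [mul_assoc 2 ‖R‖]
  exact quadratic_absorb (by positivity) he0 hd he hG hmain

/-- For exact data the iteration converges quadratically. -/
theorem norm_newtonStep_sub_solution_le {r : ℕ} {L₀ : EigSpace n k →L[ℂ] FMat n k} {ρ M Λ B : ℝ}
    (hR : RankProjLipschitz r L₀ ρ M Λ) {X : FMat n k} (hX : eigSylv S A lam X = 0)
    (hrank : mapRank (eigJac S A (eigPt lam X)) = r)
    (hXnear : ‖eigJac S A (eigPt lam X) - L₀‖ < ρ)
    (hB : ‖eigJac S A (eigPt lam X)‖ + 1 ≤ B) {x : EigSpace n k}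
    (hperp : pinv (eigJac S A (eigPt lam X)) (eigJac S A (eigPt lam X) (x - eigPt lam X)) =
      x - eigPt lam X)
    (hxnear : ‖eigJac S A x - L₀‖ < ρ) :
    ‖newtonStep r (eigMap S A) x - eigPt lam X‖ ≤ (2 * Λ * B + M) * ‖x - eigPt lam X‖ ^ 2 := by
  set J := eigJac S A (eigPt lam X) with hJ
  set w := x - eigPt lam X with hw
  set R := pinv (rankProj r J) with hRdef
  set R' := pinv (rankProj r (eigJac S A x)) with hR'def
  have hRJ : R = pinv J := by rw [hRdef, rankProj_of_mapRank hrank]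
  have hΛ := hR.lip_nonneg
  have hM := hR.bound_nonneg
  have hqle : ‖eigMap S A x - J w‖ ≤ ‖w‖ ^ 2 := by
    have h := norm_eigMap_sub_sub_le (S := S) A (eigPt lam X) x
    rwa [eigMap_eigPt_eq_zero hX, sub_zero] at h
  have hsplit : newtonStep r (eigMap S A) x - eigPt lam X =
      (R - R') (J w) - R' (eigMap S A x - J w) := by
    rw [newtonStep, fderiv_eigMap, ← hR'def, sub_apply, map_sub R', hRJ, hperp, hw]
    abel
  have h1 : ‖R - R'‖ ≤ Λ * (2 * ‖w‖) := by
    refine (hR.lipschitz _ _ hxnear hXnear).trans ?_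
    have := norm_eigJac_sub_le (S := S) A A x (eigPt lam X)
    have h0 : ofMat (A - A) = 0 := by rw [sub_self]; rfl
    rw [h0, norm_zero, zero_add, norm_sub_rev _ x] at this
    gcongr
  have h2 : ‖J w‖ ≤ B * ‖w‖ := (J.le_opNorm w).trans (by gcongr; linarith)
  rw [hsplit]
  calc _ ≤ ‖(R - R') (J w)‖ + ‖R' (eigMap S A x - J w)‖ := norm_sub_le _ _
    _ ≤ Λ * (2 * ‖w‖) * (B * ‖w‖) + M * ‖w‖ ^ 2 := by
      gcongr
      · exact ((R - R').le_opNorm _).trans (mul_le_mul h1 h2 (norm_nonneg _) (by positivity))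
      · exact (R'.le_opNorm _).trans
          (mul_le_mul (hR.bound _ hxnear) hqle (norm_nonneg _) hM)
    _ = _ := by ring

end Convergence

/-! ### The main theorem. -/

theorem theorem4 :
    ∃ α : ℝ, 0 < α ∧
      ∀ (n m k : ℕ) (A : Matrix (Fin n) (Fin n) ℂ) (lamHat : ℂ) (S : Matrix (Fin k) (Fin k) ℂ),
        HasMultiplicitySupport A lamHat m k → IsNilpotentParameter S →
        ∀ r : ℕ, r = 1 + (n - m) * k →
          -- Generic solutions are dense among all solutions.
          (eigSolutions S A lamHat ⊆ closure (genericSolutions S A lamHat)) ∧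
          -- They are exactly the solutions at which the Jacobian has rank `r`.
          (∀ XHat ∈ eigSolutions S A lamHat,
            mapRank (fderiv ℂ (eigMap S A) (eigPt lamHat XHat)) = r ↔
              XHat ∈ genericSolutions S A lamHat) ∧
          ∀ XHat ∈ genericSolutions S A lamHat,
            ∃ C K : ℝ, 0 ≤ C ∧ 0 ≤ K ∧
              ∀ η : ℝ, 0 < η → ∃ δ : ℝ, 0 < δ ∧ ∃ ε : ℝ, 0 < ε ∧
                ∀ ATilde : Matrix (Fin n) (Fin n) ℂ, ‖ofMat (ATilde - A)‖ < δ →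
                ∀ (lam₀ : ℂ) (X₀ : FMat n k), ‖eigPt lam₀ X₀ - eigPt lamHat XHat‖ < ε →
                  -- The iteration is well defined,
                  (∀ j : ℕ, RankProjDefined r (eigMap S ATilde)
                    (newtonSeq r (eigMap S ATilde) (eigPt lam₀ X₀) j)) ∧
                  ∃ (lamTilde : ℂ) (XTilde : FMat n k),
                    -- it converges,
                    Tendsto (newtonSeq r (eigMap S ATilde) (eigPt lam₀ X₀)) atTop
                      (𝓝 (eigPt lamTilde XTilde)) ∧
                    -- its limit is close to an exact solution,
                    (∃ XCheck ∈ genericSolutions S A lamHat, ‖XCheck - XHat‖ < η ∧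
                      RankProjDefined r (eigMap S A) (eigPt lamHat XCheck) ∧
                      ‖eigPt lamTilde XTilde - eigPt lamHat XCheck‖ ≤
                        α * eigCond r S A lamHat XCheck * specNorm XCheck * ‖ofMat (A - ATilde)‖
                          + C * ‖ofMat (A - ATilde)‖ ^ 2) ∧
                    -- and the convergence is quadratic for exact data.
                    (ATilde = A → ∀ j : ℕ,
                      ‖newtonSeq r (eigMap S ATilde) (eigPt lam₀ X₀) (j + 1)
                          - eigPt lamTilde XTilde‖ ≤
                        K * ‖newtonSeq r (eigMap S ATilde) (eigPt lam₀ X₀) j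
                          - eigPt lamTilde XTilde‖ ^ 2) := by
  -- The constant `2` comes from absorbing the quadratic terms in `quadratic_absorb`.
  refine ⟨2, two_pos, fun n m k A lam S hA hS r hr => ⟨eigSolutions_subset_closure hA hS,
    fun X hX => ?_, fun X₁ hX₁ => ?_⟩⟩
  · rw [fderiv_eigMap, hr]
    exact mapRank_eigJac_iff hA hS hX
  have hX₁0 : eigSylv S A lam X₁ = 0 := hX₁.1
  obtain ⟨ε₁, hε₁, hgen⟩ := exists_ball_generic hA hS hX₁
  set c := eigPt lam X₁ with hc
  set L₀ := eigJac S A c with hL₀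
  obtain ⟨ρ, M, Λ, hR⟩ := exists_rankProjLipschitz L₀
    (((mapRank_eigJac_iff hA hS hX₁.1).mpr hX₁).trans hr.symm)
  have hρ := hR.pos
  have hM := hR.bound_nonneg
  have hΛ := hR.lip_nonneg
  obtain ⟨B, hBdef⟩ : ∃ B, B = ‖L₀‖ + ‖X₁‖ + ρ + 1 := ⟨_, rfl⟩
  have hB1 : ‖L₀‖ + ρ + 1 ≤ B := by linarith [norm_nonneg X₁]
  have hB2 : ‖X₁‖ + 1 ≤ B := by linarith [norm_nonneg L₀]
  have hB0 : 0 ≤ B := by linarith [norm_nonneg X₁]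
  -- The radius `t` keeps Jacobians within `ρ` of `L₀`, nearby solutions generic and distances below
  -- one, and it supplies the two quarter bounds for halving and the absorption bound. It does not
  -- depend on `η`.
  obtain ⟨t, ⟨ht₁, ht₂, ht₃, ht₄, ht₅, ht₆⟩, ht₀⟩ := (((eventually_mul_le 4 hρ).and
    ((eventually_mul_le 1 hε₁).and ((eventually_mul_le 2 one_pos).and
    ((eventually_mul_le (M ^ 2 * (B * 2)) (by norm_num : (0 : ℝ) < 1 / 4)).and
    ((eventually_mul_le (2 * Λ * (B * 2)) (by norm_num : (0 : ℝ) < 1 / 4)).and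
    (eventually_mul_le (3 * (2 * Λ * B + M)) (by norm_num : (0 : ℝ) < 1 / 2))))))).and
    (eventually_mem_nhdsWithin (a := (0 : ℝ)) (s := Set.Ioi 0))).exists
  have ht₀' : 0 < t := ht₀
  have hJnear : ∀ (A' : Matrix (Fin n) (Fin n) ℂ) (x : EigSpace n k), ‖ofMat (A' - A)‖ < t →
      ‖x - c‖ < t → ‖eigJac S A' x - L₀‖ < ρ := by
    intro A' x hA' hx
    refine (norm_eigJac_sub_le A' A c x).trans_lt ?_
    linarith
  have h00 : ‖ofMat (A - A)‖ < t := by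
    have : ofMat (A - A) = 0 := by rw [sub_self]; rfl
    rw [this, norm_zero]; exact ht₀'
  have hsol : ∀ X : FMat n k, ‖X - X₁‖ < t →
      ‖eigJac S A (eigPt lam X) - L₀‖ < ρ ∧ ‖eigJac S A (eigPt lam X)‖ + 1 ≤ B := by
    intro X hX
    have h1 := hJnear A (eigPt lam X) h00 (by rwa [hc, norm_eigPt_sub_eigPt])
    refine ⟨h1, ?_⟩
    have := norm_sub_norm_le (eigJac S A (eigPt lam X)) L₀
    linarith
  refine ⟨2 * (2 * Λ * B + M), 2 * (M * (B * (2 * Λ * B + M))), by positivity, by positivity,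
    fun η hη => ?_⟩
  -- The factor `1 + 4 M B` bounds the total drift: the initial distance `u` plus twice a first step
  -- of size at most `M B (u + u)`.
  obtain ⟨u, ⟨hu₁, hu₂⟩, hu₀⟩ := (((eventually_mul_le 1 ht₀').and
    (eventually_mul_le (1 + 4 * M * B) (half_pos (lt_min ht₀' hη)))).and
    (eventually_mem_nhdsWithin (a := (0 : ℝ)) (s := Set.Ioi 0))).exists
  have hmin : min t η / 2 < min t η := half_lt_self (lt_min ht₀' hη)
  have hut : (1 + 4 * M * B) * u < t := hu₂.trans_lt (hmin.trans_le (min_le_left _ _))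
  have huη : (1 + 4 * M * B) * u < η := hu₂.trans_lt (hmin.trans_le (min_le_right _ _))
  refine ⟨u, hu₀, u, hu₀, fun A' hA' lam₀ X₀ hx₀ => ?_⟩
  set x₀ := eigPt lam₀ X₀
  have hA't : ‖ofMat (A' - A)‖ < t := by linarith
  have hfle : ∀ x, ‖x - c‖ < t →
      ‖eigMap S A' x‖ ≤ B * (‖x - c‖ + ‖ofMat (A' - A)‖) := by
    intro x hx
    have h1 : ‖eigMap S A x‖ ≤ B * ‖x - c‖ :=
      norm_eigMap_le hX₁0 (by linarith) (by linarith)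
    have h2 : eigMap S A' x = eigMap S A x + ofMat ((A' - A) * toMat x.snd) := by
      rw [← eigMap_sub_eigMap (S := S)]; abel
    have h3 : ‖x.snd‖ ≤ B := by
      have e1 : ‖x.snd - X₁‖ ≤ ‖x - c‖ := norm_eigSpace_snd_le (x - c)
      have e2 := norm_sub_norm_le x.snd X₁
      linarith
    have h4 : ‖ofMat ((A' - A) * toMat x.snd)‖ ≤ ‖ofMat (A' - A)‖ * B :=
      (norm_ofMat_mul_le _ _).trans (by gcongr)
    rw [h2]
    refine (norm_add_le _ _).trans ?_
    linarith
  have hx₀t : ‖x₀ - c‖ < t := by linarith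
  have hstart : ‖x₀ - c‖ + 2 * (M * ‖eigMap S A' x₀‖) ≤ (1 + 4 * M * B) * u := by
    have h1 : M * ‖eigMap S A' x₀‖ ≤ M * (B * (u + u)) := by
      gcongr
      exact (hfle x₀ hx₀t).trans (by gcongr)
    linarith
  obtain ⟨hin, z, hz, htail, hzc, hstat⟩ := newtonSeq_converges hR (f := eigMap S A') (c := c)
    (τ := t) (φ := B * (2 * t)) (x₀ := x₀)
    (fun x y => by rw [fderiv_eigMap]; exact norm_eigMap_sub_sub_le A' x y)
    (fun x y => by
      rw [fderiv_eigMap, fderiv_eigMap]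
      refine (norm_eigJac_sub_le A' A' x y).trans ?_
      have : ofMat (A' - A') = 0 := by rw [sub_self]; rfl
      rw [this, norm_zero, zero_add])
    (fun x hx => by rw [fderiv_eigMap]; exact hJnear A' x hA't hx)
    (fun x hx => (hfle x hx).trans (by gcongr; linarith))
    (by linarith) (by linarith) (hstart.trans_lt hut)
  have hzu := hzc.trans hstart
  have hzt : ‖z - c‖ < t := hzu.trans_lt hut
  rw [fderiv_eigMap] at hstat
  have hdef : ∀ (G : Matrix (Fin n) (Fin n) ℂ) (x : EigSpace n k), ‖ofMat (G - A)‖ < t →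
      ‖x - c‖ < t → RankProjDefined r (eigMap S G) x := by
    intro G x hG hx
    rw [RankProjDefined, fderiv_eigMap]
    exact hR.existsUnique _ (hJnear G x hG hx)
  obtain ⟨X, hX, hXX₁, hXnearest, hperp, hrank⟩ :=
    exists_nearest_solution hA hS hX₁0 hgen (z := z) (by linarith)
  rw [← hr] at hrank
  obtain ⟨hXnear, hXB⟩ := hsol X (hXX₁.trans_lt hzt)
  have hzB : ‖z.snd‖ ≤ B := by
    have e1 : ‖z.snd - X₁‖ ≤ ‖z - c‖ := norm_eigSpace_snd_le (z - c)
    have e2 := norm_sub_norm_le z.snd X₁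
    linarith
  have hest := norm_sub_solution_le hR (mem_eigSolutions_iff.mp hX.1) hrank hXnear hXB hzB hperp (hJnear A' z hA't hzt) hstat
    (norm_ofMat_sub_comm A A' ▸ hA't.le) ((hXnearest X₁ hX₁0).trans hzt.le) (by linarith) ht₆
  refine ⟨fun j => hdef A' _ hA't (hin j), z.fst, z.snd, hz, ⟨X, hX, (hXX₁.trans hzu).trans_lt huη,
    hdef A _ h00 ?_, ?_⟩, ?_⟩
  · rw [hc, norm_eigPt_sub_eigPt]
    exact hXX₁.trans_lt hzt
  · rw [eigCond, fderiv_eigMap]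
    exact hest
  · rintro rfl j
    -- With exact data the error estimate has zero right side, so the limit is itself an exact
    -- solution.
    have hzX : z = eigPt lam X := by
      have h0 : ofMat (A' - A') = 0 := by rw [sub_self]; rfl
      rw [h0, norm_zero] at hest
      exact sub_eq_zero.mp (norm_le_zero_iff.mp (hest.trans_eq (by ring)))
    set x := newtonSeq r (eigMap S A') x₀ with hx
    -- Quadratic decay is first obtained relative to the solution `Y` nearest to `x j`, which is no
    -- farther from it than `z`. As `f` vanishes at `Y`, the next value of `f` is quadratically
    -- small, and the tail bound `htail` turns this into a bound on the distance to `z`.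
    obtain ⟨Y, hY, hYX₁, hYnearest, hYperp, hYrank⟩ :=
      exists_nearest_solution hA hS hX₁0 hgen (z := x j) (by linarith [hin j])
    rw [← hr] at hYrank
    obtain ⟨hYnear, hYB⟩ := hsol Y (hYX₁.trans_lt (hin j))
    have hY0 : eigSylv S A' lam Y = 0 := hY.1
    have hstep := norm_newtonStep_sub_solution_le hR hY0 hYrank hYnear hYB hYperp
      (hJnear A' (x j) h00 (hin j))
    have hjY : ‖x j - eigPt lam Y‖ ≤ ‖x j - z‖ := by
      rw [hzX]; exact hYnearest X hX.1
    have hnextY : ‖x (j + 1) - eigPt lam Y‖ ≤ 1 := by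
      have e1 : ‖eigPt lam Y - c‖ < t := by
        rw [hc, norm_eigPt_sub_eigPt]; exact hYX₁.trans_lt (hin j)
      have e2 := norm_sub_le_norm_sub_add_norm_sub (x (j + 1)) c (eigPt lam Y)
      rw [norm_sub_rev c] at e2
      linarith [hin (j + 1)]
    have hf := norm_eigMap_le hY0 hYB hnextY
    calc ‖x (j + 1) - z‖ ≤ 2 * (M * ‖eigMap S A' (x (j + 1))‖) := htail (j + 1)
      _ ≤ 2 * (M * (B * ((2 * Λ * B + M) * ‖x j - z‖ ^ 2))) := by
        have e : ‖x (j + 1) - eigPt lam Y‖ ≤ (2 * Λ * B + M) * ‖x j - z‖ ^ 2 :=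
          hstep.trans (by gcongr)
        gcongr
        exact hf.trans (by gcongr)
      _ = 2 * (M * (B * (2 * Λ * B + M))) * ‖x j - z‖ ^ 2 := by ring
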